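/- ($n$-th order averaging.) Let $\mathbb T^l=\mathbb R^l/\mathbb Z^l$, let $M\subset\mathbb R^d$ be open, and let $n\ge 1$. Let $$f_\kappa(\theta,J)=(\theta+\omega_0+\kappa F(\theta,J;\kappa),\;J+\kappa G(\theta,J;\kappa))$$ on $\mathbb T^l\times M$, where $F$ and $G$ are real analytic in $(\theta,J,\kappa)$ near $\mathbb T^l\times M\times\{0\}$, with values in $\mathbb R^l$ and $\mathbb R^d$. Let $\omega_0$ be Diophantine: for some $c,\mu>0$, $|m\cdot\omega_0-q|\ge c|m|^{-\mu}$ for all $m\in\mathbb Z^l\setminus\{0\}$, $q\in\mathbb Z$. A *decoupling of order $n$* of $f$ consists of functions $F^{(k)},G^{(k)}$ ($1\le k\le n+1$), analytic in $(\theta,J,\kappa)$ near $\mathbb T^l\times M\times\{0\}$, with $F^{(1)}=F$, $G^{(1)}=G$, and analytic functions $T^{(k)},S^{(k)}$ ($1\le k\le n$) on $\mathbb T^l\times M$, such that, with $\bar F^{(k)}(J)=\int_{\mathbb T^l}F^{(k)}(\theta,J;0)\,d\theta$, $\bar G^{(k)}(J)=\int_{\mathbb T^l}G^{(k)}(\theta,J;0)\,d\theta$,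 the following hold for $1\le k\le n$. * $T^{(k)}(\psi+\omega_0,I)-T^{(k)}(\psi,I)=F^{(k)}(\psi,I;0)-\bar F^{(k)}(I)$ and $S^{(k)}(\psi+\omega_0,I)-S^{(k)}(\psi,I)=G^{(k)}(\psi,I;0)-\bar G^{(k)}(I)$. * Put $\Phi^{(k)}_\kappa(\psi,I)=(\psi+\kappa^kT^{(k)}(\psi,I),\,I+\kappa^kS^{(k)}(\psi,I))$ and $$f^{(k)}_\kappa(\theta,J)=\Big(\theta+\omega_0+\sum_{i<k}\kappa^i\bar F^{(i)}(J)+\kappa^kF^{(k)}(\theta,J;\kappa),\;J+\sum_{i<k}\kappa^i\bar G^{(i)}(J)+\kappa^kG^{(k)}(\theta,J;\kappa)\Big),$$ where $i\ge1$ in the sums. Then $\Phi^{(k)}_\kappa\circ f^{(k+1)}_\kappa=f^{(k)}_\kappa\circ\Phi^{(k)}_\kappa$ near each point of $\mathbb T^l\times M$ for all small $|\kappa|$. Then: 1. A decoupling of order $n$ exists; moreover all $T^{(k)},S^{(k)}$ can be taken with zero average over the angle $\psi$ for each $I\in M$. 2. Fix any decoupling of order $n$, any compact $K\subset M$, any open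 $U\supset K$ whose closure is a compact subset of $M$, and any $T>0$. There are $\kappa_0>0$ and $C$ such that for $|\kappa|<\kappa_0$: * for each $1\le k\le n$, $\Phi^{(k)}_\kappa$ maps $\mathbb T^l\times U$ by an analytic diffeomorphism onto an open subset of $\mathbb T^l\times M$. Let $h^{(k)}$ be the inverse of this diffeomorphism, and let $h=h^{(n)}\circ\dots\circ h^{(1)}$ on its natural domain. Both the domain and the range of $h$ contain $\mathbb T^l\times K$; * if $\kappa>0$ and $\bar I_{t+1}=\bar I_t+\sum_{k=1}^n\kappa^k\bar G^{(k)}(\bar I_t)$ is an orbit of the truncated averaged map with $\bar I_t\in K$ for all integers $0\le t<T/\kappa$, then for every orbit $(\theta_t,J_t)$ of $f_\kappa$ with $(\theta_0,J_0)$ in the domain of $h$ and $\pi h(\theta_0,J_0)=\bar I_0$, where $\pi(\psi,I)=I$, the point $(\theta_t,J_t)$ lies in the domain of $h$ and $$|\pi h(\theta_t,J_t)-\bar I_t|\le C\kappa^n\qquad\text{for all integers }0\le t<T/\kappa .$$ -/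

import Mathlib

open Set Filter Topology MeasureTheory

noncomputable section

namespace SlowFast

/-- Angle vectors in `ℝ^l`, the universal cover of the torus `𝕋^l = ℝ^l / ℤ^l`. Functions on
`𝕋^l` are written as `ℤ^l`-periodic functions of such a vector, and maps of `𝕋^l × M` as their
lifts to `ℝ^l × M`. -/
abbrev Angle (l : ℕ) : Type := Fin l → ℝ

/-- The space `ℝ^d` of slow variables, with its Euclidean norm. -/
abbrev Slow (d : ℕ) : Type := EuclideanSpace ℝ (Fin d)

/-- The lifted phase space. -/
abbrev Phase (l d : ℕ) : Type := Angle l × Slow d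

/-- `ω ∈ 𝓓(c, μ)` for some `c, μ > 0`, with `|m|` the maximum norm of the integer vector `m`. -/
def IsDiophantine {l : ℕ} (ω : Angle l) : Prop :=
  ∃ c > (0 : ℝ), ∃ μ > (0 : ℝ), ∀ m : Fin l → ℤ, m ≠ 0 → ∀ q : ℤ,
    c * ‖m‖ ^ (-μ) ≤ |∑ i, (m i : ℝ) * ω i - (q : ℝ)|

/-- The average over the torus, that is, over the unit cube. -/
def torusAverage {l : ℕ} {V : Type*} [NormedAddCommGroup V] [NormedSpace ℝ V] (g : Angle l → V) : V :=
  ∫ θ in Icc (0 : Angle l) 1, g θ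

/-- `g` has period one in each angle. -/
def IsTorusPeriodic {l : ℕ} {V : Type*} (g : Angle l → V) : Prop :=
  ∀ (m : Fin l → ℤ) (θ : Angle l), g (fun i => θ i + (m i : ℝ)) = g θ

/-- `g(θ, J; κ)` is, for every `κ`, a function on `𝕋^l × M`, and it is real analytic jointly in
`(θ, J, κ)` on some neighbourhood of `𝕋^l × M × {0}`. (This includes every function which is
analytic on `𝕋^l × M × (-κ₁, κ₁)` for some `κ₁ > 0`.) -/
structure IsAnalyticPerturbation {l d : ℕ} (M : Set (Slow d)) {V : Type*} [NormedAddCommGroup V]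
    [NormedSpace ℝ V] (g : Angle l → Slow d → ℝ → V) : Prop where
  periodic : ∀ J ∈ M, ∀ κ : ℝ, IsTorusPeriodic fun θ => g θ J κ
  analytic : AnalyticOnNhd ℝ (fun p : Angle l × Slow d × ℝ => g p.1 p.2.1 p.2.2)
    (univ ×ˢ M ×ˢ {(0 : ℝ)})

/-- `u(ψ, I)` is a real analytic function on `𝕋^l × M`. -/
structure IsAnalyticOnTorus {l d : ℕ} (M : Set (Slow d)) {V : Type*} [NormedAddCommGroup V]
    [NormedSpace ℝ V] (u : Angle l → Slow d → V) : Prop where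
  periodic : ∀ I ∈ M, IsTorusPeriodic fun ψ => u ψ I
  analytic : AnalyticOnNhd ℝ (fun p : Phase l d => u p.1 p.2) (univ ×ˢ M)

/-- The slow-fast map `(θ, J) ↦ (θ + ω₀ + κ F(θ, J; κ), J + κ G(θ, J; κ))`. -/
def slowFastMap {l d : ℕ} (ω₀ : Angle l) (F : Angle l → Slow d → ℝ → Angle l)
    (G : Angle l → Slow d → ℝ → Slow d) (κ : ℝ) (p : Phase l d) : Phase l d :=
  (p.1 + ω₀ + κ • F p.1 p.2 κ, p.2 + κ • G p.1 p.2 κ)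

/-- The functions `F^{(k)}(θ, J; κ)`, `G^{(k)}(θ, J; κ)`, `T^{(k)}(ψ, I)`, `S^{(k)}(ψ, I)` that
occur in the successive decoupling transformations, with `k` starting from `1`. -/
structure DecouplingData (l d : ℕ) where
  F : ℕ → Angle l → Slow d → ℝ → Angle l
  G : ℕ → Angle l → Slow d → ℝ → Slow d
  T : ℕ → Angle l → Slow d → Angle l
  S : ℕ → Angle l → Slow d → Slow d

namespace DecouplingData

variable {l d : ℕ} (D : DecouplingData l d)

/-- `F̄^{(k)}(J)`, the average of `F^{(k)}(θ, J; 0)`. -/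
def avgF (k : ℕ) (J : Slow d) : Angle l := torusAverage fun θ => D.F k θ J 0

/-- `Ḡ^{(k)}(J)`, the average of `G^{(k)}(θ, J; 0)`. -/
def avgG (k : ℕ) (J : Slow d) : Slow d := torusAverage fun θ => D.G k θ J 0

/-- The map in which the angles have been removed from all terms of order less than `k`:
`θ' = θ + ω₀ + ∑_{1 ≤ i < k} κ^i F̄^{(i)}(J) + κ^k F^{(k)}(θ, J; κ)`,
`J' = J + ∑_{1 ≤ i < k} κ^i Ḡ^{(i)}(J) + κ^k G^{(k)}(θ, J; κ)`. -/
def map (ω₀ : Angle l) (k : ℕ) (κ : ℝ) (p : Phase l d) : Phase l d :=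
  (p.1 + ω₀ + ∑ i ∈ Finset.Ico 1 k, κ ^ i • D.avgF i p.2 + κ ^ k • D.F k p.1 p.2 κ,
    p.2 + ∑ i ∈ Finset.Ico 1 k, κ ^ i • D.avgG i p.2 + κ ^ k • D.G k p.1 p.2 κ)

/-- `(ψ, I) ↦ (θ, J) = (ψ + κ^k T^{(k)}(ψ, I), I + κ^k S^{(k)}(ψ, I))`, the inverse of the `k`-th
decoupling transformation `h^{(k)}`. -/
def invStep (k : ℕ) (κ : ℝ) (p : Phase l d) : Phase l d :=
  (p.1 + κ ^ k • D.T k p.1 p.2, p.2 + κ ^ k • D.S k p.1 p.2)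

/-- The truncated averaged map `Ī ↦ Ī + ∑_{1 ≤ k ≤ n} κ^k Ḡ^{(k)}(Ī)`. -/
def averagedMap (n : ℕ) (κ : ℝ) (I : Slow d) : Slow d :=
  I + ∑ k ∈ Finset.Icc 1 n, κ ^ k • D.avgG k I

/-- `D` is the outcome of `n` successive decoupling steps applied to the slow-fast map given by
`F` and `G`. In step `k` the generator `(T^{(k)}, S^{(k)})` is an analytic solution of the
homological equations (its angle average is not prescribed), and `F^{(k+1)}`, `G^{(k+1)}` are the
analytic remainders of the `k`-th map written in the new variables; the change of variables is
performed near each point of `𝕋^l × M`, for all `κ` near `0`. -/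
structure IsDecoupling (M : Set (Slow d)) (ω₀ : Angle l) (F : Angle l → Slow d → ℝ → Angle l)
    (G : Angle l → Slow d → ℝ → Slow d) (n : ℕ) : Prop where
  F_one : D.F 1 = F
  G_one : D.G 1 = G
  analytic_F : ∀ k ∈ Finset.Icc 1 (n + 1), IsAnalyticPerturbation M (D.F k)
  analytic_G : ∀ k ∈ Finset.Icc 1 (n + 1), IsAnalyticPerturbation M (D.G k)
  analytic_T : ∀ k ∈ Finset.Icc 1 n, IsAnalyticOnTorus M (D.T k)
  analytic_S : ∀ k ∈ Finset.Icc 1 n, IsAnalyticOnTorus M (D.S k)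
  homological_T : ∀ k ∈ Finset.Icc 1 n, ∀ ψ : Angle l, ∀ I ∈ M,
    D.T k (ψ + ω₀) I - D.T k ψ I = D.F k ψ I 0 - D.avgF k I
  homological_S : ∀ k ∈ Finset.Icc 1 n, ∀ ψ : Angle l, ∀ I ∈ M,
    D.S k (ψ + ω₀) I - D.S k ψ I = D.G k ψ I 0 - D.avgG k I
  conjugates : ∀ k ∈ Finset.Icc 1 n, ∀ ψ : Angle l, ∀ I ∈ M,
    ∀ᶠ q : Phase l d × ℝ in 𝓝 ((ψ, I), (0 : ℝ)),
      D.invStep k q.2 (D.map ω₀ (k + 1) q.2 q.1) = D.map ω₀ k q.2 (D.invStep k q.2 q.1)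

/-- `h` is the decoupling diffeomorphism `h^{(k)}` over `U`: an analytic diffeomorphism from an
open subset of `𝕋^l × M` onto `𝕋^l × U`, whose inverse is
`(ψ, I) ↦ (ψ + κ^k T^{(k)}(ψ, I), I + κ^k S^{(k)}(ψ, I))`. -/
structure IsStepDiffeo (M U : Set (Slow d)) (k : ℕ) (κ : ℝ)
    (h : OpenPartialHomeomorph (Phase l d) (Phase l d)) : Prop where
  source_subset : h.source ⊆ univ ×ˢ M
  target_eq : h.target = univ ×ˢ U
  symm_eq : EqOn h.symm (D.invStep k κ) (univ ×ˢ U)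
  analytic : AnalyticOnNhd ℝ h h.source
  analytic_symm : AnalyticOnNhd ℝ h.symm h.target

end DecouplingData

/-- The composition `h^{(n)} ∘ ⋯ ∘ h^{(1)}` of partially defined maps, with its natural domain. -/
def compose {X : Type*} [TopologicalSpace X] (h : ℕ → OpenPartialHomeomorph X X) :
    ℕ → OpenPartialHomeomorph X X
  | 0 => OpenPartialHomeomorph.refl X
  | n + 1 => (compose h n).trans (h (n + 1))

end SlowFast

end

noncomputable section

namespace SlowFast

section TaylorBound

open Nat

variable {E V W : Type*} [NormedAddCommGroup E] [NormedSpace ℝ E] [NormedAddCommGroup V]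
  [NormedSpace ℝ V] [NormedAddCommGroup W] [NormedSpace ℝ W]

/-- `f` is the sum of its Taylor series on the ball of radius `ρ` about `z`, and the Taylor
coefficients satisfy Cauchy estimates with constants `C` and `ρ`. -/
structure TaylorBound (f : E → V) (z : E) (ρ C : ℝ) : Prop where
  pos : 0 < ρ
  bound : ∀ n, ‖iteratedFDeriv ℝ n f z‖ ≤ n ! * (C / ρ ^ n)
  hasSum : ∀ y, ‖y‖ < ρ → HasSum (fun n => (n ! : ℝ)⁻¹ • iteratedFDeriv ℝ n f z fun _ => y) (f (z + y))

theorem hasFPowerSeriesOnBall_of_bound {f : E → V} {p : FormalMultilinearSeries ℝ E V} {z : E}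
    {ρ C : ℝ} (hρ : 0 < ρ) (hp : ∀ n, ‖p n‖ ≤ C / ρ ^ n)
    (hs : ∀ y, ‖y‖ < ρ → HasSum (fun n => p n fun _ => y) (f (z + y))) :
    HasFPowerSeriesOnBall f p z (ENNReal.ofReal ρ) := by
  refine ⟨?_, by simpa using hρ, fun {y} hy => hs y ?_⟩
  · refine p.le_radius_of_bound C fun n => ?_
    rw [Real.coe_toNNReal _ hρ.le]
    exact (le_div_iff₀ (by positivity)).1 (hp n)
  · rw [Metric.mem_eball, edist_zero_right, ← ofReal_norm] at hy
    exact (ENNReal.ofReal_lt_ofReal_iff hρ).1 hy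

theorem TaylorBound.of_series [CompleteSpace V] {f : E → V} {p : FormalMultilinearSeries ℝ E V}
    {z : E} {ρ C : ℝ} (hρ : 0 < ρ) (hp : ∀ n, ‖p n‖ ≤ C / ρ ^ n)
    (hs : ∀ y, ‖y‖ < ρ → HasSum (fun n => p n fun _ => y) (f (z + y))) : TaylorBound f z ρ C := by
  have h := hasFPowerSeriesOnBall_of_bound hρ hp hs
  refine ⟨hρ, fun n => ?_, fun y hy => ?_⟩
  · refine ContinuousMultilinearMap.opNorm_le_bound ?_ fun v => ?_
    · have := (norm_nonneg (p n)).trans (hp n)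
      positivity
    rw [h.iteratedFDeriv_eq_sum_of_completeSpace v]
    refine (norm_sum_le _ _).trans ?_
    have : ∀ σ ∈ (Finset.univ : Finset (Equiv.Perm (Fin n))),
        ‖p n fun i => v (σ i)‖ ≤ C / ρ ^ n * ∏ i, ‖v i‖ := fun σ _ => by
      refine ((p n).le_opNorm _).trans ?_
      rw [Equiv.prod_comp σ fun i => ‖v i‖]
      gcongr
      exact hp n
    refine (Finset.sum_le_sum this).trans_eq ?_
    simp [Fintype.card_perm, mul_assoc]
  · refine h.hasSum_iteratedFDeriv ?_
    rw [Metric.mem_eball, edist_zero_right, ← ofReal_norm]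
    exact (ENNReal.ofReal_lt_ofReal_iff hρ).2 hy

namespace TaylorBound

variable {f : E → V} {z : E} {ρ C : ℝ}

/-- The Taylor series of `f` at `z`. -/
def _root_.SlowFast.taylor (f : E → V) (z : E) : FormalMultilinearSeries ℝ E V := fun n =>
  (n ! : ℝ)⁻¹ • iteratedFDeriv ℝ n f z

theorem norm_taylor_le (h : TaylorBound f z ρ C) (n : ℕ) : ‖taylor f z n‖ ≤ C / ρ ^ n := by
  have h1 := h.bound n
  have h2 : (0 : ℝ) < n ! := by positivity
  simp only [taylor]
  rw [norm_smul, norm_inv, Real.norm_of_nonneg h2.le, inv_mul_le_iff₀ h2]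
  exact h1

theorem _root_.SlowFast.norm_apply_const_le {n : ℕ} {p : ContinuousMultilinearMap ℝ (fun _ : Fin n => E) V}
    {ρ C : ℝ} (hp : ‖p‖ ≤ C / ρ ^ n) (y : E) : ‖p fun _ => y‖ ≤ C * (‖y‖ / ρ) ^ n := by
  refine (p.le_opNorm _).trans ?_
  simp only [Finset.prod_const, Finset.card_univ, Fintype.card_fin, div_pow]
  refine (mul_le_mul_of_nonneg_right hp (by positivity)).trans_eq ?_
  ring

theorem hasFPowerSeriesOnBall (h : TaylorBound f z ρ C) :
    HasFPowerSeriesOnBall f (taylor f z) z (ENNReal.ofReal ρ) :=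
  hasFPowerSeriesOnBall_of_bound h.pos h.norm_taylor_le h.hasSum

theorem analyticAt (h : TaylorBound f z ρ C) : AnalyticAt ℝ f z :=
  h.hasFPowerSeriesOnBall.analyticAt

theorem nonneg (h : TaylorBound f z ρ C) : 0 ≤ C := by
  simpa using (norm_nonneg _).trans (h.bound 0)

theorem mono (h : TaylorBound f z ρ C) {ρ' C' : ℝ} (hρ' : 0 < ρ') (hρ : ρ' ≤ ρ) (hC : C ≤ C') :
    TaylorBound f z ρ' C' := by
  refine ⟨hρ', fun n => (h.bound n).trans ?_, fun y hy => h.hasSum y (hy.trans_le hρ)⟩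
  have := h.nonneg
  have := this.trans hC
  gcongr

theorem norm_le (h : TaylorBound f z ρ C) : ‖f z‖ ≤ C := by
  simpa using h.bound 0

theorem _root_.AnalyticAt.eventually_taylorBound [CompleteSpace V] (hf : AnalyticAt ℝ f z) :
    ∃ ρ C : ℝ, ∀ᶠ w in 𝓝 z, TaylorBound f w ρ C := by
  obtain ⟨p, r, hp⟩ := hf
  obtain ⟨s, hs0, hs⟩ := ENNReal.lt_iff_exists_nnreal_btwn.1 hp.r_pos
  have hs0' : 0 < s := by exact_mod_cast hs0
  set t : NNReal := s / 2
  have ht : 0 < t := half_pos hs0'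
  have hts : t + t = s := add_halves s
  have hrad : (t + t : ENNReal) < p.radius := by
    rw [← ENNReal.coe_add, hts]; exact hs.trans_le hp.r_le
  have hsum := p.changeOriginSeries_summable_aux₁ hrad
  have hsum2 := (NNReal.summable_sigma.1 hsum).2
  set a : ℕ → NNReal := fun n =>
    ∑' s : Σ l : ℕ, { s : Finset (Fin (n + l)) // s.card = l }, ‖p (n + s.1)‖₊ * t ^ s.1 * t ^ n
  set C : NNReal := ∑' n, a n
  refine ⟨t, C, ?_⟩
  filter_upwards [Metric.ball_mem_nhds z (NNReal.coe_pos.2 ht)] with w hw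
  obtain ⟨x, rfl⟩ : ∃ x, w = z + x := ⟨w - z, by abel⟩
  have hx : ‖x‖₊ ≤ t := by
    have : ‖x‖ < t := by simpa using hw
    exact_mod_cast this.le
  have htr : (t : ENNReal) < r := lt_of_le_of_lt (by rw [← hts]; simp) hs
  have hxr : (‖x‖₊ : ENNReal) < r := lt_of_le_of_lt (by exact_mod_cast hx) htr
  have hc := hp.changeOrigin hxr
  refine TaylorBound.of_series (p := p.changeOrigin x) (by exact_mod_cast ht) (fun n => ?_)
    fun y hy => ?_
  · rw [le_div_iff₀ (by positivity)]
    have h1 := p.nnnorm_changeOrigin_le n (hxr.trans_le hp.r_le)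
    have h2 : ‖p.changeOrigin x n‖₊ * t ^ n ≤ C := by
      refine le_trans ?_ (hsum2.le_tsum n fun _ _ => zero_le)
      have hsn := p.changeOriginSeries_summable_aux₂ (lt_of_le_of_lt le_self_add hrad) n
      refine (mul_le_mul_left (h1.trans ?_) _).trans_eq (NNReal.tsum_mul_right _ _).symm
      have hle : ∀ s : Σ l : ℕ, { s : Finset (Fin (n + l)) // s.card = l },
          ‖p (n + s.1)‖₊ * ‖x‖₊ ^ s.1 ≤ ‖p (n + s.1)‖₊ * t ^ s.1 := fun s => by gcongr
      exact (NNReal.summable_of_le hle hsn).tsum_le_tsum hle hsn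
    exact_mod_cast h2
  · refine hc.hasSum ?_
    rw [Metric.mem_eball, edist_zero_right, enorm_eq_nnnorm]
    have hy' : ‖y‖₊ < t := by exact_mod_cast hy
    rw [lt_tsub_iff_right]
    refine lt_of_le_of_lt ?_ hs
    rw [← hts]
    push_cast
    gcongr

theorem _root_.AnalyticOnNhd.exists_taylorBound [CompleteSpace V] {K : Set E} (hK : IsCompact K)
    (hf : AnalyticOnNhd ℝ f K) : ∃ ρ > 0, ∃ C ≥ 0, ∀ w ∈ K, TaylorBound f w ρ C := by
  refine hK.induction_on (p := fun K => ∃ ρ > 0, ∃ C ≥ 0, ∀ w ∈ K, TaylorBound f w ρ C)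
    ⟨1, one_pos, 0, le_rfl, by simp⟩ ?_ ?_ ?_
  · rintro s t hst ⟨ρ, hρ, C, hC, h⟩
    exact ⟨ρ, hρ, C, hC, fun w hw => h w (hst hw)⟩
  · rintro s t ⟨ρ, hρ, C, hC, h⟩ ⟨ρ', hρ', C', hC', h'⟩
    refine ⟨min ρ ρ', lt_min hρ hρ', max C C', hC.trans (le_max_left _ _), ?_⟩
    rintro w (hw | hw)
    · exact (h w hw).mono (lt_min hρ hρ') (min_le_left _ _) (le_max_left _ _)
    · exact (h' w hw).mono (lt_min hρ hρ') (min_le_right _ _) (le_max_right _ _)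
  · intro x hx
    obtain ⟨ρ, C, h⟩ := (hf x hx).eventually_taylorBound
    exact ⟨_, mem_nhdsWithin_of_mem_nhds h, ρ, h.self_of_nhds.pos, C, h.self_of_nhds.nonneg,
      fun w hw => hw⟩

theorem tsum [CompleteSpace V] {ι : Type*} {f : ι → E → V} {b : ι → ℝ}
    (hb : Summable b) (hf : ∀ i, TaylorBound (f i) z ρ (b i)) (hρ : 0 < ρ) :
    TaylorBound (fun w => ∑' i, f i w) z ρ (∑' i, b i) := by
  have hs : ∀ n, Summable fun i => taylor (f i) z n := fun n =>
    Summable.of_norm_bounded (hb.div_const (ρ ^ n)) fun i => (hf i).norm_taylor_le n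
  refine .of_series (p := fun n => ∑' i, taylor (f i) z n) hρ (fun n => ?_) fun y hy => ?_
  · refine (tsum_of_norm_bounded (hb.div_const (ρ ^ n)).hasSum fun i => (hf i).norm_taylor_le n).trans ?_
    rw [tsum_div_const]
  · have hq : ‖y‖ / ρ < 1 := (div_lt_one hρ).2 hy
    have hq0 : 0 ≤ ‖y‖ / ρ := by positivity
    have hprod : Summable fun x : ι × ℕ => taylor (f x.1) z x.2 fun _ => y := by
      have hb0 : 0 ≤ b := fun i => (hf i).nonneg
      have hg0 : 0 ≤ fun n : ℕ => (‖y‖ / ρ) ^ n := fun n => pow_nonneg hq0 n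
      have hbg := hb.mul_of_nonneg (summable_geometric_of_lt_one hq0 hq) hb0 hg0
      refine Summable.of_norm_bounded hbg fun x => ?_
      exact norm_apply_const_le ((hf x.1).norm_taylor_le x.2) y
    have h1 : ∀ i, HasSum (fun n => taylor (f i) z n fun _ => y) (f i (z + y)) :=
      fun i => (hf i).hasSum y hy
    have h2 : ∀ n, HasSum (fun i => taylor (f i) z n fun _ => y)
        ((∑' i, taylor (f i) z n) fun _ => y) := fun n =>
      (hs n).hasSum.map (ContinuousMultilinearMap.apply ℝ (fun _ : Fin n => E) V fun _ => y)
        (ContinuousLinearMap.continuous _)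
    have h3 := hprod.hasSum.prod_fiberwise h1
    rw [h3.tsum_eq]
    have h4 := ((Equiv.prodComm ℕ ι).hasSum_iff.2 hprod.hasSum).prod_fiberwise h2
    exact h4

theorem exists_integral [CompleteSpace V] [CompleteSpace W] {S : Type*} [NormedAddCommGroup S]
    [NormedSpace ℝ S] [MeasurableSpace S] [OpensMeasurableSpace S] {μ : Measure S}
    [IsFiniteMeasureOnCompacts μ] {K : Set S} (hK : IsCompact K) {H : S × E → V} {z : E}
    (hH : ∀ s ∈ K, AnalyticAt ℝ H (s, z)) :
    ∃ ρ > 0, ∃ C ≥ 0, ∀ L : S → V →L[ℝ] W, ContinuousOn L K → (∀ s ∈ K, ‖L s‖ ≤ 1) →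
      TaylorBound (fun w => ∫ s in K, L s (H (s, w)) ∂μ) z ρ C := by
  have hK' : IsCompact (K ×ˢ ({z} : Set E)) := hK.prod isCompact_singleton
  have hH' : AnalyticOnNhd ℝ H (K ×ˢ {z}) := by
    rintro ⟨s, w⟩ ⟨hs, hw⟩
    obtain rfl : w = z := hw
    exact hH s hs
  obtain ⟨ρ, hρ, C, hC, hB⟩ := hH'.exists_taylorBound hK'
  have hB : ∀ s ∈ K, TaylorBound H (s, z) ρ C := fun s hs => hB (s, z) ⟨hs, rfl⟩
  have hm : MeasurableSet K := hK.isClosed.measurableSet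
  have : IsFiniteMeasure (μ.restrict K) := ⟨by simpa using hK.measure_lt_top⟩
  refine ⟨ρ, hρ, C * (μ.restrict K).real univ, by positivity, fun L hL hL1 => ?_⟩
  set P : S → FormalMultilinearSeries ℝ E W := fun s n =>
    (L s).compContinuousMultilinearMap
      ((taylor H (s, z) n).compContinuousLinearMap fun _ => ContinuousLinearMap.inr ℝ S E)
  have hP : ∀ s ∈ K, ∀ n, ‖P s n‖ ≤ C / ρ ^ n := fun s hs n => by
    refine (ContinuousLinearMap.norm_compContinuousMultilinearMap_le _ _).trans ?_
    refine (mul_le_of_le_one_left (norm_nonneg _) (hL1 s hs)).trans ?_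
    refine (ContinuousMultilinearMap.norm_compContinuousLinearMap_le _ _).trans ?_
    refine (mul_le_of_le_one_right (norm_nonneg _) ?_).trans ((hB s hs).norm_taylor_le n)
    exact Finset.prod_le_one (fun _ _ => norm_nonneg _)
      fun _ _ => ContinuousLinearMap.norm_inr_le_one ℝ S E
  have hPc : ∀ n, ContinuousOn (fun s => P s n) K := fun n => by
    have h1 : ContinuousOn (fun s => taylor H (s, z) n) K := by
      suffices h : ContinuousOn (fun s => iteratedFDeriv ℝ n H (s, z)) K from h.const_smul (n ! : ℝ)⁻¹
      intro s hs
      have h2 : ContinuousAt (iteratedFDeriv ℝ n H) (s, z) := (hH'.iteratedFDeriv n (s, z) ⟨hs, rfl⟩).continuousAt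
      exact (h2.comp (f := fun s => (s, z)) (by fun_prop)).continuousWithinAt
    have h3 := (ContinuousMultilinearMap.compContinuousLinearMapL (𝕜 := ℝ) (F := V)
      fun _ : Fin n => ContinuousLinearMap.inr ℝ S E).continuous.comp_continuousOn h1
    exact ((ContinuousLinearMap.compContinuousMultilinearMapL ℝ (fun _ : Fin n => E) V W
      ).continuous.comp_continuousOn hL).clm_apply h3
  have hPm : ∀ n, AEStronglyMeasurable (fun s => P s n) (μ.restrict K) := fun n =>
    (hPc n).aestronglyMeasurable_of_isCompact hK hm
  have hPb : ∀ n, ∀ᵐ s ∂μ.restrict K, ‖P s n‖ ≤ C / ρ ^ n := fun n =>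
    (ae_restrict_iff' hm).2 (.of_forall fun s hs => hP s hs n)
  have hPi : ∀ n, Integrable (fun s => P s n) (μ.restrict K) := fun n =>
    ⟨hPm n, HasFiniteIntegral.of_bounded (hPb n)⟩
  refine .of_series (p := fun n => ∫ s in K, P s n ∂μ) hρ (fun n => ?_) fun y hy => ?_
  · refine (norm_integral_le_of_norm_le_const (hPb n)).trans_eq ?_
    ring
  · have hq : ‖y‖ / ρ < 1 := (div_lt_one hρ).2 hy
    have hq0 : 0 ≤ ‖y‖ / ρ := by positivity
    set ev := fun n => ContinuousMultilinearMap.apply ℝ (fun _ : Fin n => E) W fun _ => y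
    have h1 : ∀ n, (∫ s in K, P s n ∂μ) (fun _ => y) = ∫ s in K, P s n (fun _ => y) ∂μ := fun n =>
      ((ev n).integral_comp_comm (hPi n)).symm
    have hb : ∀ n, ∀ᵐ s ∂μ.restrict K, ‖P s n fun _ => y‖ ≤ C * (‖y‖ / ρ) ^ n := fun n => by
      filter_upwards [hPb n] with s hs
      exact norm_apply_const_le hs y
    have hPy : ∀ n, Integrable (fun s => P s n fun _ => y) (μ.restrict K) := fun n =>
      (ev n).integrable_comp (hPi n)
    have h2 := hasSum_integral_of_summable_integral_norm hPy (by
      refine Summable.of_nonneg_of_le (fun n => by positivity) (fun n => ?_)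
        ((summable_geometric_of_lt_one hq0 hq).mul_left (C * (μ.restrict K).real univ))
      have := norm_integral_le_of_norm_le_const (f := fun s => ‖P s n fun _ => y‖)
        (μ := μ.restrict K) (by simpa using hb n)
      rw [Real.norm_of_nonneg (by positivity)] at this
      exact this.trans_eq (by ring))
    simp_rw [h1]
    convert! h2 using 1
    refine setIntegral_congr_fun hm fun s hs => ?_
    have h3 : HasSum (fun n => P s n fun _ => y) (L s (H (s, z + y))) := by
      have := (L s).hasSum ((hB s hs).hasSum (0, y) (by simpa using hy))
      simpa [P, taylor, Function.comp_def] using this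
    exact h3.tsum_eq.symm

end TaylorBound

end TaylorBound

section Parameters

open Nat

variable {E V : Type*} [NormedAddCommGroup E] [NormedSpace ℝ E] [NormedAddCommGroup V]
  [NormedSpace ℝ V] [CompleteSpace V]

theorem analyticAt_setIntegral {S : Type*} [NormedAddCommGroup S]
    [NormedSpace ℝ S] [MeasurableSpace S] [OpensMeasurableSpace S] {μ : Measure S}
    [IsFiniteMeasureOnCompacts μ] {K : Set S} (hK : IsCompact K) {H : S × E → V} {z : E}
    (hH : ∀ s ∈ K, AnalyticAt ℝ H (s, z)) :
    AnalyticAt ℝ (fun w => ∫ s in K, H (s, w) ∂μ) z := by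
  obtain ⟨ρ, -, C, -, h⟩ := TaylorBound.exists_integral (μ := μ) (W := V) hK hH
  exact (h (fun _ => .id ℝ V) continuousOn_const fun _ _ => ContinuousLinearMap.norm_id_le).analyticAt

/-- Hadamard's lemma for analytic functions. -/
theorem analyticAt_dslope {f : E × ℝ → V} {z : E} (hf : AnalyticAt ℝ f (z, 0)) :
    AnalyticAt ℝ (fun p : E × ℝ => dslope (fun κ => f (p.1, κ)) 0 p.2) (z, 0) := by
  have h1 : AnalyticAt ℝ (fun p : E × ℝ => ∫ s in Icc (0 : ℝ) 1, fderiv ℝ f (p.1, s * p.2) (0, 1))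
      (z, 0) := by
    refine analyticAt_setIntegral isCompact_Icc
      (H := fun q : ℝ × E × ℝ => fderiv ℝ f (q.2.1, q.1 * q.2.2) (0, 1)) fun s _ => ?_
    have h2 : AnalyticAt ℝ (fun q : ℝ × E × ℝ => (q.2.1, q.1 * q.2.2)) (s, z, 0) :=
      (analyticAt_fst.comp analyticAt_snd).prod (analyticAt_fst.mul (analyticAt_snd.comp analyticAt_snd))
    have h3 : AnalyticAt ℝ (fderiv ℝ f) ((fun q : ℝ × E × ℝ => (q.2.1, q.1 * q.2.2)) (s, z, 0)) := by
      simpa using hf.fderiv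
    exact ((ContinuousLinearMap.apply ℝ V ((0 : E), (1 : ℝ))).analyticAt _).comp (AnalyticAt.comp h3 h2)
  refine h1.congr ?_
  obtain ⟨r, hr, hball⟩ := hf.exists_ball_analyticOnNhd
  filter_upwards [Metric.ball_mem_nhds (z, (0 : ℝ)) hr] with p hp
  obtain ⟨w, κ⟩ := p
  have hmem : ∀ s ∈ Icc (0 : ℝ) 1, (w, s * κ) ∈ Metric.ball (z, (0 : ℝ)) r := fun s hs => by
    rw [← ball_prod_same] at hp ⊢
    refine ⟨hp.1, ?_⟩
    have h2 : |κ| < r := by simpa using hp.2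
    have : |s| * |κ| ≤ 1 * |κ| := by
      gcongr; rw [abs_of_nonneg hs.1]; exact hs.2
    simpa [abs_mul] using lt_of_le_of_lt this (by simpa using h2)
  have hd : ∀ s ∈ Icc (0 : ℝ) 1, HasDerivAt (fun κ => f (w, κ)) (fderiv ℝ f (w, s * κ) (0, 1)) (s * κ) :=
    fun s hs => by
      have h2 := (hball _ (hmem s hs)).differentiableAt.hasFDerivAt
      exact h2.comp_hasDerivAt (s * κ) ((hasDerivAt_const (s * κ) w).prodMk (hasDerivAt_id (s * κ)))
  simp only
  rcases eq_or_ne κ 0 with rfl | hκ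
  · simpa using (hd 0 ⟨le_rfl, zero_le_one⟩).deriv.symm
  · rw [dslope_of_ne _ hκ, slope_def_module, sub_zero, eq_inv_smul_iff₀ hκ, integral_Icc_eq_integral_Ioc,
      ← intervalIntegral.integral_of_le zero_le_one, ← intervalIntegral.integral_smul]
    have h4 : ∀ s ∈ uIcc (0 : ℝ) 1, HasDerivAt (fun s => f (w, s * κ))
        (κ • fderiv ℝ f (w, s * κ) (0, 1)) s := fun s hs => by
      rw [uIcc_of_le zero_le_one] at hs
      simpa [Function.comp_def] using (hd s hs).scomp s ((hasDerivAt_id s).mul_const κ)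
    rw [intervalIntegral.integral_eq_sub_of_hasDerivAt h4]
    · simp
    · refine ContinuousOn.intervalIntegrable fun s hs => ?_
      rw [uIcc_of_le zero_le_one] at hs
      have h5 : ContinuousAt (fderiv ℝ f) (w, s * κ) := (hball _ (hmem s hs)).fderiv.continuousAt
      have h6 : ContinuousAt (fun s => fderiv ℝ f (w, s * κ)) s :=
        h5.comp (f := fun s : ℝ => (w, s * κ)) (by fun_prop)
      exact ((h6.clm_apply continuousAt_const).const_smul κ).continuousWithinAt

theorem norm_iteratedFDeriv_of_eigenfunction {f : E → ℂ} {z e : E} {c : ℂ} (he : ‖e‖ ≤ 1)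
    (hf : AnalyticAt ℝ f z) (hfe : ∀ᶠ w in 𝓝 z, fderiv ℝ f w e = c * f w) (n k : ℕ) :
    ‖c‖ ^ k * ‖iteratedFDeriv ℝ n f z‖ ≤ ‖iteratedFDeriv ℝ (n + k) f z‖ := by
  induction k with
  | zero => simp
  | succ k ih =>
    suffices h : ∀ n, ‖c‖ * ‖iteratedFDeriv ℝ n f z‖ ≤ ‖iteratedFDeriv ℝ (n + 1) f z‖ by
      calc _ = ‖c‖ * (‖c‖ ^ k * ‖iteratedFDeriv ℝ n f z‖) := by ring
        _ ≤ ‖c‖ * ‖iteratedFDeriv ℝ (n + k) f z‖ := by gcongr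
        _ ≤ _ := h _
    intro n
    have h1 : (fun w => fderiv ℝ f w e) =ᶠ[𝓝 z] c • f := hfe
    have h2 := (h1.iteratedFDeriv ℝ n).self_of_nhds
    rw [iteratedFDeriv_const_smul_apply hf.contDiffAt] at h2
    have h3 : (fun w => fderiv ℝ f w e) = ContinuousLinearMap.apply ℝ ℂ e ∘ fderiv ℝ f := rfl
    rw [h3, ContinuousLinearMap.iteratedFDeriv_comp_left _ hf.fderiv.contDiffAt le_rfl] at h2
    calc ‖c‖ * ‖iteratedFDeriv ℝ n f z‖ = ‖c • iteratedFDeriv ℝ n f z‖ := (norm_smul _ _).symm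
      _ ≤ ‖ContinuousLinearMap.apply ℝ ℂ e‖ * ‖iteratedFDeriv ℝ n (fderiv ℝ f) z‖ := by
        rw [← h2]; exact ContinuousLinearMap.norm_compContinuousMultilinearMap_le _ _
      _ ≤ 1 * ‖iteratedFDeriv ℝ n (fderiv ℝ f) z‖ := by
        gcongr
        refine ContinuousLinearMap.opNorm_le_bound _ zero_le_one fun g => ?_
        rw [one_mul]
        exact (g.le_opNorm e).trans (mul_le_of_le_one_right (norm_nonneg _) he)
      _ = _ := by rw [one_mul, norm_iteratedFDeriv_fderiv]

theorem TaylorBound.of_eigenfunction {f : E → ℂ} {z e : E} {c : ℂ} {ρ C : ℝ}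
    (h : TaylorBound f z ρ C) (he : ‖e‖ ≤ 1) (hc : c ≠ 0)
    (hfe : ∀ᶠ w in 𝓝 z, fderiv ℝ f w e = c * f w) (k : ℕ) :
    TaylorBound f z (ρ / 2) (k ! * (2 / ρ) ^ k * C / ‖c‖ ^ k) := by
  have hρ := h.pos
  have hC := h.nonneg
  refine ⟨half_pos hρ, fun n => ?_, fun y hy => h.hasSum y (hy.trans (half_lt_self hρ))⟩
  have hc' : 0 < ‖c‖ ^ k := pow_pos (norm_pos_iff.2 hc) k
  have h1 := (norm_iteratedFDeriv_of_eigenfunction he h.analyticAt hfe n k).trans (h.bound (n + k))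
  rw [← le_div_iff₀' hc'] at h1
  refine h1.trans ?_
  have h2 : ((n + k)! : ℝ) ≤ 2 ^ (n + k) * (n ! * k !) := by
    rw [← Nat.add_choose_mul_factorial_mul_factorial]
    push_cast
    rw [mul_assoc]
    gcongr
    exact_mod_cast Nat.choose_le_two_pow _ _
  calc _ ≤ 2 ^ (n + k) * (n ! * k !) * (C / ρ ^ (n + k)) / ‖c‖ ^ k := by gcongr
    _ = _ := by
      rw [div_pow, div_pow, pow_add, pow_add]
      field_simp

theorem TaylorBound.const_mul {f : E → ℂ} {z : E} {ρ C : ℝ} (h : TaylorBound f z ρ C) (c : ℂ) :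
    TaylorBound (fun w => c * f w) z ρ (‖c‖ * C) := by
  have h1 : ∀ n, iteratedFDeriv ℝ n (fun w => c * f w) z = c • iteratedFDeriv ℝ n f z := fun n =>
    iteratedFDeriv_const_smul_apply (a := c) (f := f) h.analyticAt.contDiffAt
  refine ⟨h.pos, fun n => ?_, fun y hy => ?_⟩
  · rw [h1, norm_smul, mul_div_assoc, mul_left_comm]
    gcongr
    exact h.bound n
  · simp_rw [h1]
    convert! (h.hasSum y hy).const_smul c using 2 with n
    simp [mul_left_comm]

end Parameters

section TorusFourier

variable {l : ℕ}

/-- The projection of an angle vector to the torus. -/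
def toTorus (θ : Angle l) : UnitAddTorus (Fin l) := fun i => (θ i : UnitAddCircle)

/-- The character `θ ↦ exp (2πi m·θ)` of the torus. -/
def character (m : Fin l → ℤ) (θ : Angle l) : ℂ := UnitAddTorus.mFourier m (toTorus θ)

theorem character_eq_exp (m : Fin l → ℤ) (θ : Angle l) :
    character m θ = Complex.exp (Complex.I * ((2 * Real.pi * ∑ i, (m i : ℝ) * θ i : ℝ) : ℂ)) := by
  simp only [character, UnitAddTorus.mFourier, toTorus, ContinuousMap.coe_mk, fourier_coe_apply]
  rw [← Complex.exp_sum]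
  congr 1
  push_cast
  rw [Finset.mul_sum, Finset.mul_sum]
  refine Finset.sum_congr rfl fun i _ => ?_
  ring

theorem character_add (m : Fin l → ℤ) (θ η : Angle l) :
    character m (θ + η) = character m θ * character m η := by
  simp only [character_eq_exp, ← Complex.exp_add, ← mul_add]
  congr 2
  push_cast
  simp only [Pi.add_apply, Complex.ofReal_add, mul_add, Finset.sum_add_distrib]

theorem norm_character (m : Fin l → ℤ) (θ : Angle l) : ‖character m θ‖ = 1 := by
  rw [character_eq_exp, mul_comm, Complex.norm_exp_ofReal_mul_I]

theorem character_zero_left (θ : Angle l) : character 0 θ = 1 := by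
  simp [character_eq_exp]

theorem character_zero_right (m : Fin l → ℤ) : character m 0 = 1 := by
  simp [character_eq_exp]

theorem continuous_toTorus : Continuous (toTorus : Angle l → UnitAddTorus (Fin l)) :=
  continuous_pi fun i => (AddCircle.continuous_mk' 1).comp (continuous_apply i)

theorem continuous_character (m : Fin l → ℤ) : Continuous (character m : Angle l → ℂ) :=
  (UnitAddTorus.mFourier m).continuous.comp continuous_toTorus

theorem toTorus_add (θ η : Angle l) : toTorus (θ + η) = toTorus θ + toTorus η := rfl

theorem isOpenQuotientMap_toTorus :
    IsOpenQuotientMap (toTorus : Angle l → UnitAddTorus (Fin l)) :=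
  IsOpenQuotientMap.piMap fun _ => QuotientAddGroup.isOpenQuotientMap_mk

theorem exists_int_of_toTorus_eq {θ η : Angle l} (h : toTorus θ = toTorus η) :
    ∃ m : Fin l → ℤ, η = fun i => θ i + m i := by
  have h1 : ∀ i, ∃ k : ℤ, η i = θ i + k := fun i => by
    have h2 : ((θ i : ℝ) : UnitAddCircle) = (η i : ℝ) := congrFun h i
    obtain ⟨k, hk⟩ := (QuotientAddGroup.eq_iff_sub_mem.1 h2.symm)
    exact ⟨k, by simp at hk; linarith⟩
  choose m hm using h1
  exact ⟨m, funext hm⟩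

theorem exists_torus_lift {V : Type*} [NormedAddCommGroup V] [NormedSpace ℝ V] {g : Angle l → V} (hg : Continuous g) (hper : IsTorusPeriodic g) :
    ∃ G : C(UnitAddTorus (Fin l), V), ∀ θ, G (toTorus θ) = g θ := by
  have hq : IsQuotientMap (⟨toTorus, continuous_toTorus⟩ : C(Angle l, UnitAddTorus (Fin l))) :=
    isOpenQuotientMap_toTorus.isQuotientMap
  have hf : Function.FactorsThrough (⟨g, hg⟩ : C(Angle l, V))
      (⟨toTorus, continuous_toTorus⟩ : C(Angle l, UnitAddTorus (Fin l))) := by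
    intro θ η h
    obtain ⟨m, rfl⟩ := exists_int_of_toTorus_eq h
    exact (hper m θ).symm
  exact ⟨hq.lift ⟨g, hg⟩ hf, DFunLike.congr_fun (hq.lift_comp _ hf)⟩

attribute [local instance] instMeasureSpaceUnitAddCircle

theorem torusAverage_eq_integral {V : Type*} [NormedAddCommGroup V] [NormedSpace ℝ V]
    (G : UnitAddTorus (Fin l) → V) :
    torusAverage (fun θ => G (toTorus θ)) = ∫ t, G t := by
  rw [UnitAddTorus.integral_preimage G 0, torusAverage]
  refine (setIntegral_congr_set ?_).symm
  refine (Eq.eventuallyEq (Set.ext fun x => by simp)).trans (Measure.univ_pi_Ioc_ae_eq_Icc (μ := fun _ : Fin l => volume)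
    (f := (0 : Angle l)) (g := 1))

theorem exists_fourier {g : Angle l → ℂ} (hg : Continuous g) (hper : IsTorusPeriodic g) :
    ∃ a : (Fin l → ℤ) → ℂ,
      (∀ m ψ, torusAverage (fun θ => character (-m) θ * g (θ + ψ)) = character m ψ * a m) ∧
      (Summable a → ∀ ψ, HasSum (fun m => character m ψ * a m) (g ψ)) := by
  obtain ⟨G, hG⟩ := exists_torus_lift hg hper
  have : Measure.IsAddHaarMeasure (volume : Measure UnitAddCircle) :=
    inferInstanceAs (Measure.IsAddHaarMeasure AddCircle.haarAddCircle)
  refine ⟨UnitAddTorus.mFourierCoeff G, fun m ψ => ?_, fun ha ψ => ?_⟩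
  · have h1 : (fun θ => character (-m) θ * g (θ + ψ)) =
        fun θ => (fun t => UnitAddTorus.mFourier (-m) t * G (t + toTorus ψ)) (toTorus θ) := by
      ext θ
      simp only [← toTorus_add, hG]
      rfl
    rw [(congrArg torusAverage h1).trans (torusAverage_eq_integral fun t =>
      UnitAddTorus.mFourier (-m) t * G (t + toTorus ψ)), UnitAddTorus.mFourierCoeff,
      ← integral_add_right_eq_self (fun t => UnitAddTorus.mFourier (-m) t • G t) (toTorus ψ),
      ← integral_const_mul]
    refine integral_congr_ae (.of_forall fun t => ?_)
    obtain ⟨θ, rfl⟩ := (isOpenQuotientMap_toTorus (l := l)).surjective t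
    simp only [← toTorus_add, smul_eq_mul, ← mul_assoc]
    congr 1
    change character (-m) θ = character m ψ * character (-m) (θ + ψ)
    simp only [character_eq_exp, ← Complex.exp_add]
    congr 1
    rw [← mul_add, ← Complex.ofReal_add, ← mul_add, ← Finset.sum_add_distrib]
    congr 4
    ext i
    simp
    ring
  · rw [← hG]
    convert! UnitAddTorus.hasSum_mFourier_series_apply_of_summable ha (toTorus ψ) using 2 with m
    exact mul_comm _ _

theorem norm_character_sub_one_ge (m : Fin l → ℤ) (ω : Angle l) :
    ∃ q : ℤ, 4 * |∑ i, (m i : ℝ) * ω i - q| ≤ ‖character m ω - 1‖ := by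
  have h0 := character_eq_exp m ω
  generalize ∑ i, (m i : ℝ) * ω i = x at h0 ⊢
  refine ⟨round x, ?_⟩
  have h1 : character m ω = Complex.exp (Complex.I * ((2 * Real.pi * (x - round x) : ℝ) : ℂ)) := by
    rw [h0]
    refine (Complex.exp_periodic.int_mul (-round x) _).symm.trans ?_
    congr 1
    push_cast
    ring
  rw [h1, Complex.norm_exp_I_mul_ofReal_sub_one, norm_mul, Real.norm_of_nonneg zero_le_two,
    Real.norm_eq_abs]
  have h2 := abs_sub_round x
  have h3 : 2 * Real.pi * (x - round x) / 2 = Real.pi * (x - round x) := by ring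
  have hpi := Real.pi_pos
  have h4 := Real.mul_abs_le_abs_sin (x := Real.pi * (x - round x)) (by
    rw [abs_mul, abs_of_pos hpi]
    nlinarith)
  rw [h3]
  rw [abs_mul, abs_of_pos hpi] at h4
  have h5 : 2 / Real.pi * (Real.pi * |x - round x|) = 2 * |x - round x| := by
    field_simp
  linarith

theorem summable_norm_rpow_int {r : ℝ} (hr : r < -l) :
    Summable fun m : Fin l → ℤ => ‖m‖ ^ r := by
  set b := Pi.basisFun ℝ (Fin l)
  have hfin : Module.finrank ℤ (Submodule.span ℤ (range b)) = l := by
    rw [Module.finrank_eq_card_basis (b.restrictScalars ℤ), Fintype.card_fin]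
  have h := ZLattice.summable_norm_rpow (Submodule.span ℤ (range b)) r (by rwa [hfin])
  let φ : (Fin l → ℤ) → Submodule.span ℤ (range b) := fun m =>
    ⟨fun i => (m i : ℝ), by
      rw [b.mem_span_iff_repr_mem ℤ]
      exact fun i => ⟨m i, by simp [b]⟩⟩
  have hφ : Function.Injective φ := fun m m' hm => by
    ext i
    have := congrFun (congrArg Subtype.val hm) i
    simpa [φ] using this
  refine (h.comp_injective hφ).congr fun m => ?_
  congr 1

end TorusFourier

section HomologicalEquation

open Nat

variable {l : ℕ} {E : Type*} [NormedAddCommGroup E] [NormedSpace ℝ E] {M : Set E}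

/-- The `m`-th term of the Fourier series in the angles of a function `u(ψ, I)`. -/
def fourierTerm (u : Angle l → E → ℝ) (m : Fin l → ℤ) (p : Angle l × E) : ℂ :=
  torusAverage fun θ => character (-m) θ * (u (θ + p.1) p.2 : ℂ)

variable {u : Angle l → E → ℝ}

theorem continuous_angle {V : Type*} [NormedAddCommGroup V] [NormedSpace ℝ V] {u : Angle l → E → V}
    (hu : AnalyticOnNhd ℝ (fun p : Angle l × E => u p.1 p.2) (univ ×ˢ M)) {I : E} (hI : I ∈ M) :
    Continuous fun ψ => u ψ I :=
  continuous_iff_continuousAt.2 fun ψ =>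
    (hu (ψ, I) ⟨mem_univ _, hI⟩).continuousAt.comp (f := fun ψ => (ψ, I)) (by fun_prop)

theorem exists_fourierTerm_eq (hu : AnalyticOnNhd ℝ (fun p : Angle l × E => u p.1 p.2) (univ ×ˢ M))
    {I : E} (hI : I ∈ M) (hper : IsTorusPeriodic fun ψ => u ψ I) :
    ∃ a : (Fin l → ℤ) → ℂ, (∀ m ψ, fourierTerm u m (ψ, I) = character m ψ * a m) ∧
      (Summable a → ∀ ψ, HasSum (fun m => fourierTerm u m (ψ, I)) (u ψ I : ℂ)) := by
  have hc : Continuous fun ψ => (u ψ I : ℂ) := Complex.continuous_ofReal.comp (continuous_angle hu hI)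
  obtain ⟨a, h1, h2⟩ := exists_fourier hc fun m θ => congrArg Complex.ofReal (hper m θ)
  refine ⟨a, h1, fun ha ψ => ?_⟩
  convert! h2 ha ψ using 2 with m
  exact h1 m ψ

theorem fourierTerm_add (hu : AnalyticOnNhd ℝ (fun p : Angle l × E => u p.1 p.2) (univ ×ˢ M))
    {I : E} (hI : I ∈ M) (hper : IsTorusPeriodic fun ψ => u ψ I) (m : Fin l → ℤ) (ψ s : Angle l) :
    fourierTerm u m (ψ + s, I) = character m s * fourierTerm u m (ψ, I) := by
  obtain ⟨a, h1, -⟩ := exists_fourierTerm_eq hu hI hper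
  rw [h1, h1, character_add]
  ring

theorem fourierTerm_zero (hu : AnalyticOnNhd ℝ (fun p : Angle l × E => u p.1 p.2) (univ ×ˢ M))
    {I : E} (hI : I ∈ M) (hper : IsTorusPeriodic fun ψ => u ψ I) (ψ : Angle l) :
    fourierTerm u 0 (ψ, I) = (torusAverage fun θ => u θ I : ℝ) := by
  have h := fourierTerm_add hu hI hper 0 0 ψ
  rw [zero_add, character_zero_left, one_mul] at h
  rw [h]
  simp only [fourierTerm, neg_zero, character_zero_left, one_mul, add_zero, torusAverage]
  exact integral_ofReal

theorem exists_taylorBound_fourierTerm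
    (hu : AnalyticOnNhd ℝ (fun p : Angle l × E => u p.1 p.2) (univ ×ˢ M)) {ψ : Angle l} {I : E}
    (hI : I ∈ M) : ∃ ρ > 0, ∃ C ≥ 0, ∀ m, TaylorBound (fourierTerm u m) (ψ, I) ρ C := by
  obtain ⟨ρ, hρ, C, hC, h⟩ := TaylorBound.exists_integral (μ := (volume : Measure (Angle l)))
    (W := ℂ) (K := Icc 0 1) isCompact_Icc
    (H := fun q : Angle l × Angle l × E => (u (q.1 + q.2.1) q.2.2 : ℂ)) (z := (ψ, I))
    fun s _ => by
      have h1 : AnalyticAt ℝ (fun q : Angle l × Angle l × E => (q.1 + q.2.1, q.2.2)) (s, ψ, I) :=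
        (analyticAt_fst.add (analyticAt_fst.comp analyticAt_snd)).prod
          (analyticAt_snd.comp analyticAt_snd)
      have h2 : AnalyticAt ℝ (fun p : Angle l × E => (u p.1 p.2 : ℂ)) (s + ψ, I) :=
        (Complex.ofRealCLM.analyticAt _).comp (hu (s + ψ, I) ⟨mem_univ _, hI⟩)
      exact AnalyticAt.comp_of_eq h2 h1 rfl
  refine ⟨ρ, hρ, C, hC, fun m => h (fun θ => ContinuousLinearMap.mul ℝ ℂ (character (-m) θ)) ?_ ?_⟩
  · exact ((ContinuousLinearMap.mul ℝ ℂ).continuous.comp (continuous_character _)).continuousOn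
  · intro s _
    rw [ContinuousLinearMap.opNorm_mul_apply, norm_character]

theorem fderiv_fourierTerm
    (hu : AnalyticOnNhd ℝ (fun p : Angle l × E => u p.1 p.2) (univ ×ˢ M))
    (hper : ∀ I ∈ M, IsTorusPeriodic fun ψ => u ψ I) {ψ : Angle l} {I : E} (hI : I ∈ M)
    (m : Fin l → ℤ) (i : Fin l) :
    fderiv ℝ (fourierTerm u m) (ψ, I) (Pi.single i 1, 0) =
      (2 * Real.pi * Complex.I * m i) * fourierTerm u m (ψ, I) := by
  obtain ⟨ρ, hρ, C, hC, h⟩ := exists_taylorBound_fourierTerm (ψ := ψ) hu hI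
  have h1 := (h m).analyticAt.differentiableAt.hasFDerivAt
  have h2 : HasDerivAt (fun t : ℝ => (ψ + t • Pi.single i 1, I)) ((Pi.single i 1 : Angle l), (0 : E)) 0 := by
    refine HasDerivAt.prodMk ?_ (hasDerivAt_const _ _)
    simpa using ((hasDerivAt_id (0 : ℝ)).smul_const (Pi.single i 1 : Angle l)).const_add ψ
  have h3 : HasDerivAt (fun t : ℝ => fourierTerm u m (ψ + t • Pi.single i 1, I))
      (fderiv ℝ (fourierTerm u m) (ψ, I) (Pi.single i 1, 0)) 0 :=
    HasFDerivAt.comp_hasDerivAt (l := fourierTerm u m) (0 : ℝ) (by simpa using h1) h2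
  have h4 : (fun t : ℝ => fourierTerm u m (ψ + t • Pi.single i 1, I)) =
      fun t : ℝ => Complex.exp ((2 * Real.pi * Complex.I * m i) * t) * fourierTerm u m (ψ, I) := by
    ext t
    rw [fourierTerm_add hu hI (hper I hI), character_eq_exp]
    congr 2
    simp [Pi.single_apply]
    ring
  rw [h4] at h3
  have h5 : HasDerivAt (fun t : ℝ => Complex.exp ((2 * Real.pi * Complex.I * m i) * t) *
      fourierTerm u m (ψ, I)) ((2 * Real.pi * Complex.I * m i) * fourierTerm u m (ψ, I)) 0 := by
    have h6 : HasDerivAt (fun t : ℝ => (2 * Real.pi * Complex.I * m i) * (t : ℂ))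
        (2 * Real.pi * Complex.I * m i) 0 := by
      simpa using (Complex.ofRealCLM.hasDerivAt (x := (0 : ℝ))).const_mul (2 * Real.pi * Complex.I * m i : ℂ)
    simpa using (h6.cexp.mul_const (fourierTerm u m (ψ, I)))
  exact h3.unique h5

theorem exists_decay_fourierTerm (hM : IsOpen M)
    (hu : AnalyticOnNhd ℝ (fun p : Angle l × E => u p.1 p.2) (univ ×ˢ M))
    (hper : ∀ I ∈ M, IsTorusPeriodic fun ψ => u ψ I) (ψ : Angle l) {I : E} (hI : I ∈ M) (k : ℕ) :
    ∃ ρ > 0, ∃ C ≥ 0, ∀ m ≠ 0, TaylorBound (fourierTerm u m) (ψ, I) ρ (C * ‖m‖ ^ (-k : ℝ)) := by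
  obtain ⟨ρ, hρ, C, hC, h⟩ := exists_taylorBound_fourierTerm (ψ := ψ) hu hI
  refine ⟨ρ / 2, half_pos hρ, k ! * (2 / ρ) ^ k * C / (2 * Real.pi) ^ k, by positivity, fun m hm => ?_⟩
  obtain ⟨i, hi⟩ : ∃ i, ‖m i‖ = ‖m‖ := by
    have : Nonempty (Fin l) := by
      by_contra hne
      rw [not_nonempty_iff] at hne
      exact hm (Subsingleton.elim _ _)
    obtain ⟨i, -, hi⟩ := Finset.exists_max_image Finset.univ (fun i => ‖m i‖) Finset.univ_nonempty
    exact ⟨i, le_antisymm (norm_le_pi_norm m i)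
      ((pi_norm_le_iff_of_nonempty _).2 fun j => hi j (Finset.mem_univ j))⟩
  have hmi : m i ≠ 0 := fun h0 => hm (norm_eq_zero.1 (by rw [← hi, h0, norm_zero]))
  set c : ℂ := 2 * Real.pi * Complex.I * m i
  have hcn : ‖c‖ = 2 * Real.pi * ‖m‖ := by
    have h1 : ‖m i‖ = |(m i : ℝ)| := by rw [Int.norm_eq_abs]
    simp only [c, ← hi, norm_mul, Complex.norm_I, Complex.norm_intCast, Complex.norm_real, h1]
    simp [abs_of_pos Real.pi_pos]
  have hc : c ≠ 0 := by
    simp [c, hmi, Real.pi_ne_zero]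
  have h2 := (h m).of_eigenfunction (e := (Pi.single i 1, 0)) (c := c) (by simp [Prod.norm_def, Pi.norm_single]) hc (by
    filter_upwards [(isOpen_univ.prod hM).mem_nhds (show (ψ, I) ∈ univ ×ˢ M from ⟨mem_univ _, hI⟩)]
      with p hp
    exact fderiv_fourierTerm hu hper hp.2 m i) k
  convert! h2 using 1
  rw [hcn, mul_pow, Real.rpow_neg (norm_nonneg _), Real.rpow_natCast]
  have : 0 < ‖m‖ := norm_pos_iff.2 hm
  have := Real.pi_pos
  field_simp
  ring

theorem exists_homological_scalar (hM : IsOpen M) {ω : Angle l} (hω : IsDiophantine ω)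
    (hu : AnalyticOnNhd ℝ (fun p : Angle l × E => u p.1 p.2) (univ ×ˢ M))
    (hper : ∀ I ∈ M, IsTorusPeriodic fun ψ => u ψ I) :
    ∃ T : Angle l → E → ℝ, AnalyticOnNhd ℝ (fun p : Angle l × E => T p.1 p.2) (univ ×ˢ M) ∧
      (∀ I ∈ M, IsTorusPeriodic fun ψ => T ψ I) ∧
      ∀ ψ, ∀ I ∈ M, T (ψ + ω) I - T ψ I = u ψ I - torusAverage fun θ => u θ I := by
  classical
  obtain ⟨c, hc, μ, hμ, hdio⟩ := hω
  obtain ⟨k, hk⟩ := exists_nat_gt (l + μ)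
  set D : (Fin l → ℤ) → ℂ := fun m => if m = 0 then 0 else (character m ω - 1)⁻¹
  have hD : ∀ m ≠ 0, ‖character m ω - 1‖ ≥ 4 * (c * ‖m‖ ^ (-μ)) := fun m hm => by
    obtain ⟨q, hq⟩ := norm_character_sub_one_ge m ω
    linarith [hdio m hm q]
  have hpos : ∀ m : Fin l → ℤ, m ≠ 0 → 0 < ‖m‖ := fun m hm => norm_pos_iff.2 hm
  have hD0 : ∀ m ≠ 0, character m ω - 1 ≠ 0 := fun m hm => by
    have h1 := hpos m hm
    exact norm_pos_iff.1 (lt_of_lt_of_le (by positivity) (hD m hm))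
  have hDn : ∀ m ≠ 0, ‖D m‖ ≤ (4 * c)⁻¹ * ‖m‖ ^ μ := fun m hm => by
    have h1 := hpos m hm
    simp only [D, hm, if_false, norm_inv]
    refine (inv_anti₀ (by positivity) (hD m hm)).trans_eq ?_
    rw [Real.rpow_neg h1.le]
    field_simp
  have hsum : Summable fun m : Fin l → ℤ => ‖m‖ ^ (μ - k) := summable_norm_rpow_int (by linarith)
  have hsum' : Summable fun m : Fin l → ℤ => ‖m‖ ^ (-k : ℝ) := summable_norm_rpow_int (by linarith)
  set v : (Fin l → ℤ) → Angle l × E → ℂ := fun m p => D m * fourierTerm u m p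
  have hv : ∀ ψ, ∀ I ∈ M, ∃ ρ > 0, ∃ C ≥ 0, ∀ m, TaylorBound (v m) (ψ, I) ρ (C * ‖m‖ ^ (μ - k)) := by
    intro ψ I hI
    obtain ⟨ρ, hρ, C, hC, h⟩ := exists_decay_fourierTerm hM hu hper ψ hI k
    refine ⟨ρ, hρ, (4 * c)⁻¹ * C, by positivity, fun m => ?_⟩
    by_cases hm : m = 0
    · have h0 : v m = fun _ => 0 := by ext; simp [v, D, hm]
      rw [h0]
      refine .of_series (p := fun _ => 0) hρ (fun n => ?_) fun y _ => ?_
      · rw [norm_zero]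
        positivity
      · exact hasSum_zero
    · refine ((h m hm).const_mul (D m)).mono hρ le_rfl ?_
      have h1 := hpos m hm
      calc ‖D m‖ * (C * ‖m‖ ^ (-k : ℝ)) ≤ ((4 * c)⁻¹ * ‖m‖ ^ μ) * (C * ‖m‖ ^ (-k : ℝ)) := by
            gcongr; exact hDn m hm
        _ = _ := by rw [sub_eq_add_neg, Real.rpow_add h1]; ring
  have hvs : ∀ ψ, ∀ I ∈ M, Summable fun m => v m (ψ, I) := fun ψ I hI => by
    obtain ⟨ρ, hρ, C, hC, h⟩ := hv ψ I hI
    exact Summable.of_norm_bounded (hsum.mul_left C) fun m => (h m).norm_le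
  refine ⟨fun ψ I => (∑' m, v m (ψ, I)).re, ?_, ?_, ?_⟩
  · rintro ⟨ψ, I⟩ ⟨-, hI⟩
    obtain ⟨ρ, hρ, C, hC, h⟩ := hv ψ I hI
    exact (Complex.reCLM.analyticAt _).comp (TaylorBound.tsum (hsum.mul_left C) h hρ).analyticAt
  · intro I hI m θ
    have h1 : ∀ n, v n (fun i => θ i + (m i : ℝ), I) = v n (θ, I) := fun n => by
      simp only [v, fourierTerm]
      congr 2
      ext η
      congr 2
      refine Eq.trans ?_ (hper I hI m (η + θ))
      refine congrArg (u · I) ?_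
      ext i
      simp [add_assoc]
    simp only [h1]
  · intro ψ I hI
    obtain ⟨a, ha, hs⟩ := exists_fourierTerm_eq hu hI (hper I hI)
    have hasum : Summable a := by
      obtain ⟨ρ, hρ, C, hC, h⟩ := exists_decay_fourierTerm hM hu hper 0 hI k
      refine Summable.of_norm_bounded_eventually (hsum'.mul_left C) ?_
      filter_upwards [(Set.finite_singleton (0 : Fin l → ℤ)).compl_mem_cofinite] with m hm
      have := (h m hm).norm_le
      rwa [ha, character_zero_right, one_mul] at this
    have h1 := hs hasum ψ
    have h2 : ∀ m, v m (ψ + ω, I) - v m (ψ, I) =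
        fourierTerm u m (ψ, I) - if m = 0 then ((torusAverage fun θ => u θ I : ℝ) : ℂ) else 0 := fun m => by
      simp only [v]
      rw [fourierTerm_add hu hI (hper I hI)]
      by_cases hm : m = 0
      · subst hm
        simp [D, fourierTerm_zero hu hI (hper I hI)]
      · have := hD0 m hm
        simp only [D, hm, if_false, sub_zero]
        field_simp
    have h3 := h1.sub (hasSum_ite_eq (0 : Fin l → ℤ) ((torusAverage fun θ => u θ I : ℝ) : ℂ))
    have h4 := ((hvs (ψ + ω) I hI).hasSum.sub (hvs ψ I hI).hasSum)
    simp only [h2] at h4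
    have h5 := h4.unique h3
    rw [← Complex.sub_re, h5]
    simp

end HomologicalEquation

section VectorHomological

variable {l d : ℕ} {V W : Type*} [NormedAddCommGroup V] [NormedSpace ℝ V]
  [NormedAddCommGroup W] [NormedSpace ℝ W] {M : Set (Slow d)}

theorem torusAverage_const [CompleteSpace V] (c : V) : torusAverage (fun _ : Angle l => c) = c := by
  rw [torusAverage, setIntegral_const, Measure.real, Real.volume_Icc_pi]
  simp

theorem torusAverage_sub {g h : Angle l → V} (hg : Continuous g) (hh : Continuous h) :
    torusAverage (fun θ => g θ - h θ) = torusAverage g - torusAverage h :=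
  integral_sub (hg.continuousOn.integrableOn_compact isCompact_Icc)
    (hh.continuousOn.integrableOn_compact isCompact_Icc)

theorem torusAverage_clm [CompleteSpace V] [CompleteSpace W] (L : V →L[ℝ] W) {g : Angle l → V}
    (hg : Continuous g) : torusAverage (fun θ => L (g θ)) = L (torusAverage g) :=
  L.integral_comp_comm (hg.continuousOn.integrableOn_compact isCompact_Icc)

theorem IsAnalyticOnTorus.continuous {u : Angle l → Slow d → V} (hu : IsAnalyticOnTorus M u)
    {I : Slow d} (hI : I ∈ M) : Continuous fun ψ => u ψ I :=
  continuous_angle hu.analytic hI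

theorem IsAnalyticOnTorus.average [CompleteSpace V] {u : Angle l → Slow d → V}
    (hu : IsAnalyticOnTorus M u) :
    AnalyticOnNhd ℝ (fun I => torusAverage fun ψ => u ψ I) M := fun I hI =>
  analyticAt_setIntegral (H := fun p : Angle l × Slow d => u p.1 p.2) isCompact_Icc
    fun s _ => hu.analytic (s, I) ⟨mem_univ _, hI⟩

theorem IsAnalyticPerturbation.slice {g : Angle l → Slow d → ℝ → V}
    (hg : IsAnalyticPerturbation M g) : IsAnalyticOnTorus M fun ψ I => g ψ I 0 where
  periodic I hI := hg.periodic I hI 0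
  analytic := fun p hp => by
    have h1 : AnalyticAt ℝ (fun p : Phase l d => (p.1, p.2, (0 : ℝ))) p :=
      analyticAt_fst.prod (analyticAt_snd.prod analyticAt_const)
    exact (hg.analytic (p.1, p.2, 0) ⟨mem_univ _, hp.2, rfl⟩).comp_of_eq h1 rfl

theorem IsAnalyticOnTorus.exists_homological [FiniteDimensional ℝ V] (hM : IsOpen M) {ω : Angle l}
    (hω : IsDiophantine ω) {u : Angle l → Slow d → V} (hu : IsAnalyticOnTorus M u) :
    ∃ T : Angle l → Slow d → V, IsAnalyticOnTorus M T ∧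
      (∀ ψ, ∀ I ∈ M, T (ψ + ω) I - T ψ I = u ψ I - torusAverage fun θ => u θ I) ∧
      ∀ I ∈ M, torusAverage (fun ψ => T ψ I) = 0 := by
  have := FiniteDimensional.complete ℝ V
  set b := Module.finBasis ℝ V
  set c : Fin (Module.finrank ℝ V) → V →L[ℝ] ℝ := fun i => LinearMap.toContinuousLinearMap (b.coord i)
  have h1 : ∀ i, ∃ T : Angle l → Slow d → ℝ,
      AnalyticOnNhd ℝ (fun p : Angle l × Slow d => T p.1 p.2) (univ ×ˢ M) ∧
      (∀ I ∈ M, IsTorusPeriodic fun ψ => T ψ I) ∧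
      ∀ ψ, ∀ I ∈ M, T (ψ + ω) I - T ψ I = c i (u ψ I) - torusAverage fun θ => c i (u θ I) := fun i =>
    exists_homological_scalar hM hω (u := fun ψ I => c i (u ψ I))
      (fun p hp => ((c i).analyticAt _).comp (hu.analytic p hp))
      fun I hI m θ => congrArg (c i) (hu.periodic I hI m θ)
  choose T hTa hTp hTh using h1
  set T₀ : Angle l → Slow d → V := fun ψ I => ∑ i, T i ψ I • b i
  have hT₀ : IsAnalyticOnTorus M T₀ := by
    refine ⟨fun I hI m θ => ?_, fun p hp => ?_⟩
    · simp only [T₀]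
      exact Finset.sum_congr rfl fun i _ => congrArg (· • b i) (hTp i I hI m θ)
    · exact Finset.analyticAt_fun_sum _ fun i _ => (hTa i p hp).smul analyticAt_const
  have hav := hT₀.average
  refine ⟨fun ψ I => T₀ ψ I - torusAverage fun θ => T₀ θ I, ⟨fun I hI m θ => ?_, fun p hp => ?_⟩,
    fun ψ I hI => ?_, fun I hI => ?_⟩
  · exact congrArg (· - torusAverage fun θ => T₀ θ I) (hT₀.periodic I hI m θ)
  · exact (hT₀.analytic p hp).sub ((hav p.2 hp.2).comp_of_eq analyticAt_snd rfl)
  · rw [sub_sub_sub_cancel_right]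
    have h2 : ∀ i, T i (ψ + ω) I - T i ψ I = b.coord i (u ψ I - torusAverage fun θ => u θ I) := fun i => by
      rw [hTh i ψ I hI, torusAverage_clm (c i) (hu.continuous hI), ← map_sub]
      rfl
    simp only [T₀, ← Finset.sum_sub_distrib, ← sub_smul, h2, Module.Basis.coord_apply, b.sum_repr]
  · rw [torusAverage_sub (hT₀.continuous hI) continuous_const, torusAverage_const, sub_self]

end VectorHomological

section AbstractStep

variable {Z : Type*} [NormedAddCommGroup Z] [NormedSpace ℝ Z]

/-- A solution `y` of `y + s X(w + y) = 0` with `‖y‖ ≤ √|s|`, so that `w + y` is a preimage of `w`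
under `z ↦ z + s X(z)`. -/
def displacement (X : Z → Z) (w : Z) (s : ℝ) : Z :=
  Classical.epsilon fun y => y + s • X (w + y) = 0 ∧ ‖y‖ ≤ √|s|

theorem displacement_add {X : Z → Z} {τ : Z} (hX : ∀ z, X (z + τ) = X z) (w : Z) (s : ℝ) :
    displacement X (w + τ) s = displacement X w s := by
  simp only [displacement, add_right_comm w τ, hX]

theorem displacement_zero (X : Z → Z) (w : Z) : displacement X w 0 = 0 := by
  have h := Classical.epsilon_spec (p := fun y => y + (0 : ℝ) • X (w + y) = 0 ∧ ‖y‖ ≤ √|(0 : ℝ)|)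
    ⟨0, by simp⟩
  change displacement X w 0 + _ = 0 ∧ _ at h
  simpa using h.1

theorem analyticAt_displacement [CompleteSpace Z] {X : Z → Z} {w₀ : Z} (hX : AnalyticAt ℝ X w₀) :
    AnalyticAt ℝ (fun q : Z × ℝ => displacement X q.1 q.2) (w₀, 0) ∧
      ∀ᶠ q : Z × ℝ in 𝓝 (w₀, 0),
        displacement X q.1 q.2 + q.2 • X (q.1 + displacement X q.1 q.2) = 0 := by
  set Θ : ℝ × Z → ℝ × Z := fun p => (p.1, p.2 + p.1 • X p.2)
  have hX' : AnalyticAt ℝ (fun p : ℝ × Z => X p.2) (0, w₀) := hX.comp_of_eq analyticAt_snd rfl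
  have hΘ : ContDiffAt ℝ ⊤ Θ (0, w₀) :=
    (analyticAt_fst.prod (analyticAt_snd.add (analyticAt_fst.smul hX'))).contDiffAt
  have hΘ0 : Θ (0, w₀) = (0, w₀) := by simp [Θ]
  set A : (ℝ × Z) ≃L[ℝ] (ℝ × Z) := ContinuousLinearEquiv.skewProd (.refl ℝ ℝ) (.refl ℝ Z)
    (ContinuousLinearMap.toSpanSingleton ℝ (X w₀))
  have hΘ' : HasFDerivAt Θ (A : (ℝ × Z) →L[ℝ] (ℝ × Z)) (0, w₀) := by
    have h1 := (hasFDerivAt_fst (𝕜 := ℝ) (p := ((0 : ℝ), w₀))).prodMk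
      ((hasFDerivAt_snd (𝕜 := ℝ) (p := ((0 : ℝ), w₀))).add
        ((hasFDerivAt_fst (𝕜 := ℝ) (p := ((0 : ℝ), w₀))).smul hX'.differentiableAt.hasFDerivAt))
    convert! h1 using 1
    ext <;> simp [A]
  have hn : (⊤ : WithTop ℕ∞) ≠ 0 := by simp
  set e := hΘ.toOpenPartialHomeomorph Θ hΘ' hn
  have hes : e.source ∈ 𝓝 (0, w₀) :=
    e.open_source.mem_nhds (hΘ.mem_toOpenPartialHomeomorph_source hΘ' hn)
  have het : e.target ∈ 𝓝 (0, w₀) := by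
    have := hΘ.image_mem_toOpenPartialHomeomorph_target hΘ' hn
    rw [hΘ0] at this
    exact e.open_target.mem_nhds this
  have hg : AnalyticAt ℝ e.symm (0, w₀) := by
    have := hΘ.to_localInverse hΘ' hn
    rw [hΘ0] at this
    exact this.analyticAt
  have hg0 : e.symm (0, w₀) = (0, w₀) := by
    have := e.left_inv (mem_of_mem_nhds hes)
    change e.symm (Θ (0, w₀)) = _ at this
    rwa [hΘ0] at this
  set φ : Z × ℝ → Z := fun q => (e.symm (q.2, q.1)).2 - q.1
  have hswap : AnalyticAt ℝ (fun q : Z × ℝ => (q.2, q.1)) (w₀, 0) :=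
    analyticAt_snd.prod analyticAt_fst
  have hφ : AnalyticAt ℝ φ (w₀, 0) :=
    (analyticAt_snd.comp (hg.comp_of_eq hswap rfl)).sub analyticAt_fst
  have hφ0 : φ (w₀, 0) = 0 := by simp [φ, hg0]
  have hφeq : ∀ᶠ q : Z × ℝ in 𝓝 (w₀, 0), φ q + q.2 • X (q.1 + φ q) = 0 := by
    filter_upwards [hswap.continuousAt.preimage_mem_nhds het] with q hq
    have h1 : Θ (e.symm (q.2, q.1)) = (q.2, q.1) := e.right_inv hq
    have h2 : (e.symm (q.2, q.1)).1 = q.2 := congrArg Prod.fst h1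
    have h3 := congrArg Prod.snd h1
    simp only [Θ, h2] at h3
    simp only [φ, add_sub_cancel]
    rw [sub_add_eq_add_sub, h3, sub_self]
  have hsmall : ∀ᶠ q : Z × ℝ in 𝓝 (w₀, 0), ‖φ q‖ ≤ √|q.2| := by
    have h1 : ContinuousAt (fun q : Z × ℝ => |q.2| * ‖X (q.1 + φ q)‖ ^ 2) (w₀, 0) := by
      have h2 : ContinuousAt (fun q : Z × ℝ => X (q.1 + φ q)) (w₀, 0) :=
        ContinuousAt.comp_of_eq hX.continuousAt (continuousAt_fst.add hφ.continuousAt) (by simp [hφ0])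
      exact continuousAt_snd.abs.mul (h2.norm.pow 2)
    have h3 := h1.eventually_lt (continuousAt_const (y := (1 : ℝ))) (by simp)
    filter_upwards [h3, hφeq] with q hq hq'
    refine Real.le_sqrt_of_sq_le ?_
    have h4 : ‖φ q‖ = |q.2| * ‖X (q.1 + φ q)‖ := by
      rw [← Real.norm_eq_abs, ← norm_smul, ← norm_neg (q.2 • _), ← eq_neg_of_add_eq_zero_left hq']
    calc ‖φ q‖ ^ 2 = |q.2| * (|q.2| * ‖X (q.1 + φ q)‖ ^ 2) := by rw [h4]; ring
      _ ≤ |q.2| * 1 := by gcongr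
      _ = |q.2| := mul_one _
  have huniq : ∀ᶠ q : Z × ℝ in 𝓝 (w₀, 0), ∀ y, ‖y‖ ≤ √|q.2| → (q.2, q.1 + y) ∈ e.source := by
    obtain ⟨r, hr, hball⟩ := Metric.mem_nhds_iff.1 hes
    have h1 : ContinuousAt (fun q : Z × ℝ => |q.2| + (‖q.1 - w₀‖ + √|q.2|)) (w₀, 0) := by fun_prop
    filter_upwards [h1.eventually_lt (continuousAt_const (y := r)) (by simpa using hr)] with q hq y hy
    refine hball ?_
    have hs := Real.sqrt_nonneg |q.2|
    rw [← ball_prod_same]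
    refine ⟨?_, ?_⟩
    · simp only [Metric.mem_ball, dist_zero_right, Real.norm_eq_abs]
      have := norm_nonneg (q.1 - w₀)
      linarith
    · rw [Metric.mem_ball, dist_eq_norm]
      have h2 : q.1 + y - w₀ = (q.1 - w₀) + y := by abel
      rw [h2]
      have := norm_add_le (q.1 - w₀) y
      have := abs_nonneg q.2
      linarith
  have heq : ∀ᶠ q : Z × ℝ in 𝓝 (w₀, 0), φ q = displacement X q.1 q.2 := by
    filter_upwards [hφeq, hsmall, huniq] with q h1 h2 h3
    obtain ⟨h4, h5⟩ := Classical.epsilon_spec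
      (p := fun y => y + q.2 • X (q.1 + y) = 0 ∧ ‖y‖ ≤ √|q.2|) ⟨φ q, h1, h2⟩
    change displacement X q.1 q.2 + _ = 0 at h4
    have h6 : ∀ y, y + q.2 • X (q.1 + y) = 0 → ‖y‖ ≤ √|q.2| → y = φ q := fun y hy hy' => by
      have h7 := e.left_inv (h3 y hy')
      change e.symm (Θ (q.2, q.1 + y)) = _ at h7
      simp only [Θ, add_assoc, hy, add_zero] at h7
      simp [φ, h7]
    exact (h6 _ h4 h5).symm
  refine ⟨hφ.congr heq, ?_⟩
  filter_upwards [hφeq, heq] with q h1 h2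
  rwa [← h2]

end AbstractStep

section AbstractStep

variable {Z : Type*} [NormedAddCommGroup Z] [NormedSpace ℝ Z]

/-- The map `z ↦ z + Ω + ∑_{1 ≤ i < k} κ^i a_i(z) + κ^k P(z; κ)`. -/
def partialMap (Ω : Z) (a : ℕ → Z → Z) (k : ℕ) (P : Z → ℝ → Z) (κ : ℝ) (z : Z) : Z :=
  z + Ω + ∑ i ∈ Finset.Ico 1 k, κ ^ i • a i z + κ ^ k • P z κ

theorem partialMap_zero {Ω : Z} {a : ℕ → Z → Z} {k : ℕ} (hk : 1 ≤ k) {P : Z → ℝ → Z} (z : Z) :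
    partialMap Ω a k P 0 z = z + Ω := by
  have h : ∑ i ∈ Finset.Ico 1 k, (0 : ℝ) ^ i • a i z = 0 := Finset.sum_eq_zero fun i hi => by
    rw [zero_pow (by have := (Finset.mem_Ico.1 hi).1; lia), zero_smul]
  rw [partialMap, h, zero_pow (by lia), zero_smul, add_zero, add_zero]

theorem analyticAt_pow_smul {f : Z × ℝ → Z} {q : Z × ℝ} (hf : AnalyticAt ℝ f q) (k : ℕ) :
    AnalyticAt ℝ (fun q : Z × ℝ => q.2 ^ k • f q) q :=
  (analyticAt_snd.pow k).smul hf

theorem analyticAt_partialMap {Ω : Z} {a : ℕ → Z → Z} {k : ℕ} {P : Z → ℝ → Z} {z : Z} {κ : ℝ}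
    (ha : ∀ i ∈ Finset.Ico 1 k, AnalyticAt ℝ (a i) z)
    (hP : AnalyticAt ℝ (fun q : Z × ℝ => P q.1 q.2) (z, κ)) :
    AnalyticAt ℝ (fun q : Z × ℝ => partialMap Ω a k P q.2 q.1) (z, κ) := by
  refine ((analyticAt_fst.add analyticAt_const).add ?_).add (analyticAt_pow_smul hP k)
  exact Finset.analyticAt_fun_sum _ fun i hi =>
    analyticAt_pow_smul ((ha i hi).comp_of_eq analyticAt_fst rfl) i

theorem exists_step_of_forall [CompleteSpace Z] {D : Set Z} (hD : IsOpen D) {Ω : Z}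
    (hΩ : ∀ z ∈ D, z + Ω ∈ D) {a : ℕ → Z → Z} {k : ℕ} (hk : 1 ≤ k) {P : Z → ℝ → Z} {X : Z → Z}
    (ha : ∀ i ∈ Finset.Ico 1 k, ∀ z ∈ D, AnalyticAt ℝ (a i) z)
    (hP : ∀ z ∈ D, AnalyticAt ℝ (fun q : Z × ℝ => P q.1 q.2) (z, 0))
    (hX : ∀ z ∈ D, AnalyticAt ℝ X z) (hom : ∀ z ∈ D, X (z + Ω) - X z = P z 0 - a k z) :
    ∃ R : Z → ℝ → Z,
      (∀ τ : Z, (∀ i z, a i (z + τ) = a i z) → (∀ z κ, P (z + τ) κ = P z κ) →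
        (∀ z, X (z + τ) = X z) → ∀ z κ, R (z + τ) κ = R z κ) ∧
      (∀ z ∈ D, AnalyticAt ℝ (fun q : Z × ℝ => R q.1 q.2) (z, 0)) ∧
      ∀ z ∈ D, ∀ᶠ q : Z × ℝ in 𝓝 (z, 0),
        partialMap Ω a (k + 1) R q.2 q.1 + q.2 ^ k • X (partialMap Ω a (k + 1) R q.2 q.1) =
          partialMap Ω a k P q.2 (q.1 + q.2 ^ k • X q.1) := by
  have h0k : (0 : ℝ) ^ k = 0 := zero_pow (by lia)
  set Φ : Z × ℝ → Z := fun q => q.1 + q.2 ^ k • X q.1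
  set v : Z × ℝ → Z := fun q => partialMap Ω a k P q.2 (Φ q)
  set W : Z × ℝ → Z := fun q => v q + displacement X (v q) (q.2 ^ k)
  set B : ℕ → Z × ℝ → Z := fun i q => dslope (fun s => a i (q.1 + s • X q.1)) 0 q.2
  set Q : Z × ℝ → Z := fun q => X (q.1 + Ω) - X (W q) + (P (Φ q) q.2 - P q.1 0) +
    ∑ i ∈ Finset.Ico 1 k, q.2 ^ i • B i (q.1, q.2 ^ k)
  set R : Z → ℝ → Z := fun z κ => dslope (fun κ => Q (z, κ)) 0 κ
  have hΦ0 : ∀ z, Φ (z, 0) = z := fun z => by simp [Φ, h0k]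
  have hv0 : ∀ z, v (z, 0) = z + Ω := fun z => by simp only [v, partialMap_zero hk, hΦ0]
  have hW0 : ∀ z, W (z, 0) = z + Ω := fun z => by
    simp only [W, hv0, h0k, displacement_zero, add_zero]
  have hQ0 : ∀ z, Q (z, 0) = 0 := fun z => by
    have : ∑ i ∈ Finset.Ico 1 k, (0 : ℝ) ^ i • B i (z, 0 ^ k) = 0 := Finset.sum_eq_zero fun i hi => by
      rw [zero_pow (by have := (Finset.mem_Ico.1 hi).1; lia), zero_smul]
    simp only [Q, hW0, hΦ0, this, sub_self, add_zero]
  have hQR : ∀ z κ, κ • R z κ = Q (z, κ) := fun z κ => by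
    have := sub_smul_dslope (fun κ => Q (z, κ)) 0 κ
    simpa [hQ0] using this
  have hB : ∀ i z s, s • B i (z, s) = a i (z + s • X z) - a i z := fun i z s => by
    have := sub_smul_dslope (fun s => a i (z + s • X z)) 0 s
    simpa using this
  have han : ∀ z ∈ D, AnalyticAt ℝ Q (z, 0) ∧
      ∀ᶠ q : Z × ℝ in 𝓝 (z, 0), displacement X (v q) (q.2 ^ k) + q.2 ^ k • X (W q) = 0 := by
    intro z hz
    have hXz : AnalyticAt ℝ (fun q : Z × ℝ => X q.1) (z, 0) :=
      (hX z hz).comp_of_eq analyticAt_fst rfl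
    have hΦ : AnalyticAt ℝ Φ (z, 0) := analyticAt_fst.add (analyticAt_pow_smul hXz k)
    have hΦp : AnalyticAt ℝ (fun q => (Φ q, q.2)) (z, 0) := hΦ.prod analyticAt_snd
    have hΦp0 : (fun q : Z × ℝ => (Φ q, q.2)) (z, 0) = (z, 0) := by simp only [hΦ0]
    have hv : AnalyticAt ℝ v (z, 0) :=
      (analyticAt_partialMap (fun i hi => ha i hi z hz) (hP z hz)).comp_of_eq hΦp hΦp0
    have hvp : AnalyticAt ℝ (fun q : Z × ℝ => (v q, q.2 ^ k)) (z, 0) :=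
      hv.prod (analyticAt_snd.pow k)
    have hvp0 : (fun q : Z × ℝ => (v q, q.2 ^ k)) (z, 0) = (z + Ω, 0) := by simp only [hv0, h0k]
    obtain ⟨hd, hd'⟩ := analyticAt_displacement (hX _ (hΩ z hz))
    have hW : AnalyticAt ℝ W (z, 0) := hv.add (hd.comp_of_eq hvp hvp0)
    refine ⟨?_, ?_⟩
    · refine AnalyticAt.add (AnalyticAt.add (AnalyticAt.sub ?_ ?_) (AnalyticAt.sub ?_ ?_)) ?_
      · exact (hX _ (hΩ z hz)).comp_of_eq (analyticAt_fst.add analyticAt_const) rfl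
      · exact (hX _ (hΩ z hz)).comp_of_eq hW (hW0 z)
      · exact (hP z hz).comp_of_eq hΦp hΦp0
      · exact (hP z hz).comp_of_eq (analyticAt_fst.prod analyticAt_const) rfl
      · refine Finset.analyticAt_fun_sum _ fun i hi => ?_
        refine analyticAt_pow_smul ?_ i
        have h1 : AnalyticAt ℝ (B i) (z, 0) := analyticAt_dslope
          (f := fun q : Z × ℝ => a i (q.1 + q.2 • X q.1))
          ((ha i hi z hz).comp_of_eq (analyticAt_fst.add (analyticAt_snd.smul hXz)) (by simp))
        exact h1.comp_of_eq (analyticAt_fst.prod (analyticAt_snd.pow k)) (by simp only [h0k])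
    · have h := hvp.continuousAt.tendsto
      simp only [hv0, h0k] at h
      exact h.eventually hd'
  refine ⟨R, fun τ h1 h2 h3 z κ => ?_, fun z hz => analyticAt_dslope (han z hz).1, fun z hz => ?_⟩
  · have hΦτ : ∀ q : Z × ℝ, Φ (q.1 + τ, q.2) = Φ q + τ := fun q => by
      simp only [Φ, h3, add_right_comm]
    have hvτ : ∀ q : Z × ℝ, v (q.1 + τ, q.2) = v q + τ := fun q => by
      simp only [v, hΦτ, partialMap, h1, h2]
      abel
    have hWτ : ∀ q : Z × ℝ, W (q.1 + τ, q.2) = W q + τ := fun q => by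
      simp only [W, hvτ, displacement_add h3, add_right_comm]
    have hBτ : ∀ i (q : Z × ℝ), B i (q.1 + τ, q.2) = B i q := fun i q => by
      simp only [B, h3, add_right_comm _ τ, h1]
    have hQτ : ∀ q : Z × ℝ, Q (q.1 + τ, q.2) = Q q := fun q => by
      have : ∀ i, B i (q.1 + τ, q.2 ^ k) = B i (q.1, q.2 ^ k) := fun i => hBτ i (q.1, q.2 ^ k)
      simp only [Q, hWτ, hΦτ, add_right_comm _ τ, h2, h3, this]
    simp only [R]
    congr 1
    ext κ
    exact hQτ (z, κ)
  · filter_upwards [(han z hz).2, continuousAt_fst.preimage_mem_nhds (hD.mem_nhds hz)] with q hq hqD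
    obtain ⟨w, κ⟩ := q
    have hWv : W (w, κ) + κ ^ k • X (W (w, κ)) = v (w, κ) := by
      rw [show W (w, κ) + κ ^ k • X (W (w, κ)) = v (w, κ) +
        (displacement X (v (w, κ)) (κ ^ k) + κ ^ k • X (W (w, κ))) from add_assoc _ _ _]
      rw [show _ = (0 : Z) from hq, add_zero]
    have hWR : partialMap Ω a (k + 1) R κ w = W (w, κ) := by
      rw [eq_sub_of_add_eq hWv]
      have h1 : ∀ i, κ ^ i • a i (Φ (w, κ)) = κ ^ i • a i w + κ ^ k • κ ^ i • B i (w, κ ^ k) := fun i => by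
        rw [smul_comm, hB, ← smul_add]
        simp only [Φ, add_sub_cancel]
      have h2 : κ ^ (k + 1) • R w κ = κ ^ k • Q (w, κ) := by rw [pow_succ, mul_smul, hQR]
      have h3 : a k w = P w 0 - (X (w + Ω) - X w) := by rw [hom w hqD]; abel
      simp only [v, partialMap, h1, h2, Finset.sum_Ico_succ_top hk, Finset.sum_add_distrib,
        ← Finset.smul_sum, h3, Q]
      simp only [Φ]
      module
    simp only
    rw [hWR, hWv]

/-- One decoupling step: the map of order `k` is conjugated, by `z ↦ z + κ^k X(z)` with `X` a solution
of the homological equation, to a map of order `k + 1`. -/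
theorem exists_step [CompleteSpace Z] {D : Set Z} (hD : IsOpen D) {Ω : Z}
    (hΩ : ∀ z ∈ D, z + Ω ∈ D) {Λ : Set Z} (hΛ : ∀ τ ∈ Λ, ∀ z, z + τ ∈ D ↔ z ∈ D)
    {a : ℕ → Z → Z} {k : ℕ} (hk : 1 ≤ k) {P : Z → ℝ → Z} {X : Z → Z}
    (ha : ∀ i ∈ Finset.Icc 1 k, ∀ z ∈ D, AnalyticAt ℝ (a i) z)
    (haΛ : ∀ τ ∈ Λ, ∀ i, ∀ z ∈ D, a i (z + τ) = a i z)
    (hP : ∀ z ∈ D, AnalyticAt ℝ (fun q : Z × ℝ => P q.1 q.2) (z, 0))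
    (hPΛ : ∀ τ ∈ Λ, ∀ z ∈ D, ∀ κ, P (z + τ) κ = P z κ)
    (hX : ∀ z ∈ D, AnalyticAt ℝ X z) (hXΛ : ∀ τ ∈ Λ, ∀ z ∈ D, X (z + τ) = X z)
    (hom : ∀ z ∈ D, X (z + Ω) - X z = P z 0 - a k z) :
    ∃ R : Z → ℝ → Z, (∀ τ ∈ Λ, ∀ z κ, R (z + τ) κ = R z κ) ∧
      (∀ z ∈ D, AnalyticAt ℝ (fun q : Z × ℝ => R q.1 q.2) (z, 0)) ∧
      ∀ z ∈ D, ∀ᶠ q : Z × ℝ in 𝓝 (z, 0),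
        partialMap Ω a (k + 1) R q.2 q.1 + q.2 ^ k • X (partialMap Ω a (k + 1) R q.2 q.1) =
          partialMap Ω a k P q.2 (q.1 + q.2 ^ k • X q.1) := by
  classical
  set a' : ℕ → Z → Z := fun i => D.indicator (a i)
  set P' : Z → ℝ → Z := fun z κ => D.indicator (P · κ) z
  set X' : Z → Z := D.indicator X
  have hev : ∀ z ∈ D, ∀ᶠ w in 𝓝 z, w ∈ D := fun z hz => hD.mem_nhds hz
  have hind : ∀ (f : Z → Z), ∀ τ ∈ Λ, (∀ z ∈ D, f (z + τ) = f z) →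
      ∀ z, D.indicator f (z + τ) = D.indicator f z := fun f τ hτ hf z => by
    by_cases hz : z ∈ D
    · rw [indicator_of_mem hz, indicator_of_mem ((hΛ τ hτ z).2 hz), hf z hz]
    · rw [indicator_of_notMem hz, indicator_of_notMem fun h => hz ((hΛ τ hτ z).1 h)]
  have hanal : ∀ (f : Z → Z), ∀ z ∈ D, AnalyticAt ℝ f z → AnalyticAt ℝ (D.indicator f) z :=
    fun f z hz hf => hf.congr ((hev z hz).mono fun w hw => (indicator_of_mem hw f).symm)
  obtain ⟨R, h1, h2, h3⟩ := exists_step_of_forall hD hΩ (a := a') hk (P := P') (X := X')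
    (fun i hi z hz => hanal _ z hz (ha i (Finset.Ico_subset_Icc_self hi) z hz))
    (fun z hz => (hP z hz).congr (by
      filter_upwards [continuousAt_fst.preimage_mem_nhds (hD.mem_nhds hz)] with q hq
      exact (indicator_of_mem (show q.1 ∈ D from hq) (P · q.2)).symm))
    (fun z hz => hanal _ z hz (hX z hz))
    (fun z hz => by
      simp only [X', P', a', indicator_of_mem hz, indicator_of_mem (hΩ z hz), hom z hz])
  have hP' : ∀ τ ∈ Λ, ∀ z κ, P' (z + τ) κ = P' z κ := fun τ hτ z κ =>
    hind (P · κ) τ hτ (fun z hz => hPΛ τ hτ z hz κ) z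
  refine ⟨R, fun τ hτ => h1 τ (fun i => hind _ τ hτ (haΛ τ hτ i)) (hP' τ hτ)
    (hind _ τ hτ (hXΛ τ hτ)), h2, fun z hz => ?_⟩
  have h0k : (0 : ℝ) ^ k = 0 := zero_pow (by lia)
  have hΦ : ContinuousAt (fun q : Z × ℝ => q.1 + q.2 ^ k • X q.1) (z, 0) :=
    (analyticAt_fst.add (analyticAt_pow_smul ((hX z hz).comp_of_eq analyticAt_fst rfl) k)).continuousAt
  have hW : ContinuousAt (fun q : Z × ℝ => partialMap Ω a (k + 1) R q.2 q.1) (z, 0) :=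
    (analyticAt_partialMap (fun i hi => ha i (by simp at hi ⊢; lia) z hz) (h2 z hz)).continuousAt
  filter_upwards [h3 z hz, continuousAt_fst.preimage_mem_nhds (hD.mem_nhds hz),
    hΦ.preimage_mem_nhds (hD.mem_nhds (by simpa [h0k] using hz)),
    hW.preimage_mem_nhds (hD.mem_nhds (by simpa [partialMap_zero] using hΩ z hz))] with q h4 h5 h6 h7
  have h8 : ∀ w ∈ D, ∀ j, ∀ S : Z → ℝ → Z, partialMap Ω a' j S q.2 w = partialMap Ω a j S q.2 w :=
    fun w hw j S => by simp only [partialMap, a', indicator_of_mem hw]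
  simp only [mem_preimage] at h5 h6 h7
  have h9 : X' q.1 = X q.1 := indicator_of_mem h5 X
  have h10 : X' (partialMap Ω a (k + 1) R q.2 q.1) = X (partialMap Ω a (k + 1) R q.2 q.1) :=
    indicator_of_mem h7 X
  rw [h8 _ h5, h9, h8 _ h6, h10] at h4
  rw [h4]
  simp only [partialMap, P', indicator_of_mem h6]

end AbstractStep

section Existence

variable {l d : ℕ} {M : Set (Slow d)}

/-- The vector of the lattice of periods of the lifted phase space given by an integer vector. -/
def period (m : Fin l → ℤ) : Phase l d := (fun i => (m i : ℝ), 0)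

namespace DecouplingData

/-- The averages of order `k`, as functions on the phase space. -/
def avg (D : DecouplingData l d) (k : ℕ) (z : Phase l d) : Phase l d := (D.avgF k z.2, D.avgG k z.2)

/-- The remainders `F^{(k)}` and `G^{(k)}` as one function. -/
def remainder (D : DecouplingData l d) (k : ℕ) (z : Phase l d) (κ : ℝ) : Phase l d :=
  (D.F k z.1 z.2 κ, D.G k z.1 z.2 κ)

/-- The generators `T^{(k)}` and `S^{(k)}` as one function. -/
def generator (D : DecouplingData l d) (k : ℕ) (z : Phase l d) : Phase l d :=
  (D.T k z.1 z.2, D.S k z.1 z.2)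

theorem map_eq_partialMap (D : DecouplingData l d) (ω₀ : Angle l) (k : ℕ) (κ : ℝ) (z : Phase l d) :
    D.map ω₀ k κ z = partialMap (ω₀, 0) (D.avg) k (D.remainder k) κ z := by
  ext1
  · simp [map, partialMap, avg, remainder, Prod.fst_sum]
  · simp [map, partialMap, avg, remainder, Prod.snd_sum]

theorem invStep_eq (D : DecouplingData l d) (k : ℕ) (κ : ℝ) (z : Phase l d) :
    D.invStep k κ z = z + κ ^ k • D.generator k z := rfl

end DecouplingData

theorem IsAnalyticPerturbation.analyticAt {V : Type*} [NormedAddCommGroup V] [NormedSpace ℝ V]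
    {g : Angle l → Slow d → ℝ → V} (hg : IsAnalyticPerturbation M g) {z : Phase l d} (hz : z.2 ∈ M) :
    AnalyticAt ℝ (fun q : Phase l d × ℝ => g q.1.1 q.1.2 q.2) (z, 0) := by
  have h : AnalyticAt ℝ (fun q : Phase l d × ℝ => (q.1.1, q.1.2, q.2)) (z, 0) :=
    (analyticAt_fst.comp analyticAt_fst).prod
      ((analyticAt_snd.comp analyticAt_fst).prod analyticAt_snd)
  exact (hg.analytic (z.1, z.2, 0) ⟨mem_univ _, hz, rfl⟩).comp_of_eq h rfl

theorem isAnalyticPerturbation_of {V : Type*} [NormedAddCommGroup V] [NormedSpace ℝ V]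
    {g : Phase l d → ℝ → V} (hper : ∀ m z κ, g (z + period m) κ = g z κ)
    (hg : ∀ z : Phase l d, z.2 ∈ M → AnalyticAt ℝ (fun q : Phase l d × ℝ => g q.1 q.2) (z, 0)) :
    IsAnalyticPerturbation M fun ψ I κ => g (ψ, I) κ where
  periodic I _ κ m θ := by
    refine Eq.trans ?_ (hper m (θ, I) κ)
    exact congrArg (g · κ) (Prod.ext rfl (add_zero I).symm)
  analytic := by
    rintro ⟨ψ, I, κ⟩ ⟨-, hI, rfl : κ = 0⟩
    have h : AnalyticAt ℝ (fun q : Angle l × Slow d × ℝ => ((q.1, q.2.1), q.2.2)) (ψ, I, 0) :=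
      (analyticAt_fst.prod (analyticAt_fst.comp analyticAt_snd)).prod
        (analyticAt_snd.comp analyticAt_snd)
    exact (hg (ψ, I) hI).comp_of_eq h rfl

namespace DecouplingData

theorem IsDecoupling.analyticOnNhd_avg {D : DecouplingData l d} {ω₀ : Angle l}
    {F : Angle l → Slow d → ℝ → Angle l} {G : Angle l → Slow d → ℝ → Slow d} {n : ℕ}
    (hD : D.IsDecoupling M ω₀ F G n) {k : ℕ} (hk : k ∈ Finset.Icc 1 (n + 1)) {z : Phase l d}
    (hz : z.2 ∈ M) : AnalyticAt ℝ (D.avg k) z :=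
  (((hD.analytic_F k hk).slice.average z.2 hz).comp_of_eq analyticAt_snd rfl).prod
    (((hD.analytic_G k hk).slice.average z.2 hz).comp_of_eq analyticAt_snd rfl)

theorem IsDecoupling.exists_succ (hM : IsOpen M) {ω₀ : Angle l} (hω₀ : IsDiophantine ω₀)
    {D : DecouplingData l d} {F : Angle l → Slow d → ℝ → Angle l} {G : Angle l → Slow d → ℝ → Slow d}
    {n : ℕ} (hD : D.IsDecoupling M ω₀ F G n)
    (hav : ∀ k ∈ Finset.Icc 1 n, ∀ I ∈ M,
      (torusAverage fun ψ => D.T k ψ I) = 0 ∧ (torusAverage fun ψ => D.S k ψ I) = 0) :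
    ∃ D' : DecouplingData l d, D'.IsDecoupling M ω₀ F G (n + 1) ∧
      ∀ k ∈ Finset.Icc 1 (n + 1), ∀ I ∈ M,
        (torusAverage fun ψ => D'.T k ψ I) = 0 ∧ (torusAverage fun ψ => D'.S k ψ I) = 0 := by
  have hmem : n + 1 ∈ Finset.Icc 1 (n + 1) := by simp
  obtain ⟨T, hT, hTh, hTa⟩ := (hD.analytic_F _ hmem).slice.exists_homological hM hω₀
  obtain ⟨S, hS, hSh, hSa⟩ := (hD.analytic_G _ hmem).slice.exists_homological hM hω₀
  set X : Phase l d → Phase l d := fun z => (T z.1 z.2, S z.1 z.2)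
  obtain ⟨R, hR1, hR2, hR3⟩ := exists_step (Z := Phase l d) (D := univ ×ˢ M) (isOpen_univ.prod hM)
    (Ω := (ω₀, 0)) (fun z hz => ⟨mem_univ _, by simpa using hz.2⟩) (Λ := range period)
    (by rintro _ ⟨m, rfl⟩ z; simp [period]) (a := D.avg) (k := n + 1) (by lia)
    (P := D.remainder (n + 1)) (X := X) (fun i hi z hz => hD.analyticOnNhd_avg hi hz.2)
    (by rintro _ ⟨m, rfl⟩ i z hz; simp [period, avg])
    (fun z hz => ((hD.analytic_F _ hmem).analyticAt hz.2).prod ((hD.analytic_G _ hmem).analyticAt hz.2))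
    (by
      rintro _ ⟨m, rfl⟩ z hz κ
      simp only [remainder, period, Prod.snd_add, add_zero]
      exact Prod.ext ((hD.analytic_F _ hmem).periodic _ hz.2 κ m z.1)
        ((hD.analytic_G _ hmem).periodic _ hz.2 κ m z.1))
    (fun z hz => (hT.analytic z hz).prod (hS.analytic z hz))
    (by
      rintro _ ⟨m, rfl⟩ z hz
      simp only [X, period, Prod.snd_add, add_zero]
      exact Prod.ext (hT.periodic _ hz.2 m z.1) (hS.periodic _ hz.2 m z.1))
    (by
      intro z hz
      simp only [X, Prod.snd_add, add_zero]
      exact Prod.ext (hTh z.1 z.2 hz.2) (hSh z.1 z.2 hz.2))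
  have hRp : ∀ m z κ, R (z + period m) κ = R z κ := fun m z κ => hR1 _ ⟨m, rfl⟩ z κ
  have hRa : ∀ z : Phase l d, z.2 ∈ M → AnalyticAt ℝ (fun q : Phase l d × ℝ => R q.1 q.2) (z, 0) :=
    fun z hz => hR2 z ⟨mem_univ _, hz⟩
  set D' : DecouplingData l d :=
    { F := Function.update D.F (n + 2) fun ψ I κ => (R (ψ, I) κ).1
      G := Function.update D.G (n + 2) fun ψ I κ => (R (ψ, I) κ).2
      T := Function.update D.T (n + 1) T
      S := Function.update D.S (n + 1) S }
  have hF : ∀ {i}, i ≤ n + 1 → D'.F i = D.F i := fun {i} hi => Function.update_of_ne (by lia) _ _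
  have hG : ∀ {i}, i ≤ n + 1 → D'.G i = D.G i := fun {i} hi => Function.update_of_ne (by lia) _ _
  have hTn : ∀ {i}, i ≤ n → D'.T i = D.T i := fun {i} hi => Function.update_of_ne (by lia) _ _
  have hSn : ∀ {i}, i ≤ n → D'.S i = D.S i := fun {i} hi => Function.update_of_ne (by lia) _ _
  have hF' : D'.F (n + 2) = fun ψ I κ => (R (ψ, I) κ).1 := Function.update_self _ _ _
  have hG' : D'.G (n + 2) = fun ψ I κ => (R (ψ, I) κ).2 := Function.update_self _ _ _
  have hT' : D'.T (n + 1) = T := Function.update_self _ _ _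
  have hS' : D'.S (n + 1) = S := Function.update_self _ _ _
  have havg : ∀ i ≤ n + 1, D'.avg i = D.avg i := fun i hi => by
    unfold avg avgF avgG; simp only [hF hi, hG hi]
  have havgF : ∀ i ≤ n + 1, D'.avgF i = D.avgF i := fun i hi => by
    unfold avgF; simp only [hF hi]
  have havgG : ∀ i ≤ n + 1, D'.avgG i = D.avgG i := fun i hi => by
    unfold avgG; simp only [hG hi]
  have hpm : ∀ k ≤ n + 2, ∀ P : Phase l d → ℝ → Phase l d, ∀ κ z,
      partialMap (ω₀, 0) D'.avg k P κ z = partialMap (ω₀, 0) D.avg k P κ z := fun k hk P κ z => by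
    have : ∑ i ∈ Finset.Ico 1 k, κ ^ i • D'.avg i z = ∑ i ∈ Finset.Ico 1 k, κ ^ i • D.avg i z :=
      Finset.sum_congr rfl fun i hi => by rw [havg i (by simp at hi; lia)]
    simp only [partialMap, this]
  have hmap : ∀ k ≤ n + 1, D'.map ω₀ k = D.map ω₀ k := fun k hk => by
    ext1 κ; ext1 z
    have : D'.remainder k = D.remainder k := by
      unfold remainder; simp only [hF hk, hG hk]
    rw [map_eq_partialMap, map_eq_partialMap, hpm k (by lia), this]
  have hmap' : ∀ κ z, D'.map ω₀ (n + 1 + 1) κ z = partialMap (ω₀, 0) D.avg (n + 1 + 1) R κ z :=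
    fun κ z => by
      have : D'.remainder (n + 2) = R := by
        unfold remainder; simp only [hF', hG']
      rw [map_eq_partialMap, hpm _ le_rfl, this]
  have hinv : ∀ k ≤ n, D'.invStep k = D.invStep k := fun k hk => by
    unfold invStep; simp only [hTn hk, hSn hk]
  have hinv' : ∀ κ z, D'.invStep (n + 1) κ z = z + κ ^ (n + 1) • X z := fun κ z => by
    unfold invStep; simp only [hT', hS']; rfl
  have hcases : ∀ {k m}, k ∈ Finset.Icc 1 (m + 1) → k ∈ Finset.Icc 1 m ∨ k = m + 1 := fun {k m} hk => by
    simp only [Finset.mem_Icc] at hk ⊢; lia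
  have hle : ∀ {k m}, k ∈ Finset.Icc 1 m → k ≤ m := fun hk => (Finset.mem_Icc.1 hk).2
  refine ⟨D', ⟨?_, ?_, ?_, ?_, ?_, ?_, ?_, ?_, ?_⟩, ?_⟩
  · rw [hF (by lia), hD.F_one]
  · rw [hG (by lia), hD.G_one]
  · intro k hk
    rcases hcases hk with hk | rfl
    · rw [hF (hle hk)]; exact hD.analytic_F k hk
    · rw [hF']
      exact isAnalyticPerturbation_of (g := fun z κ => (R z κ).1) (fun m z κ => by rw [hRp])
        fun z hz => analyticAt_fst.comp (hRa z hz)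
  · intro k hk
    rcases hcases hk with hk | rfl
    · rw [hG (hle hk)]; exact hD.analytic_G k hk
    · rw [hG']
      exact isAnalyticPerturbation_of (g := fun z κ => (R z κ).2) (fun m z κ => by rw [hRp])
        fun z hz => analyticAt_snd.comp (hRa z hz)
  · intro k hk
    rcases hcases hk with hk | rfl
    · rw [hTn (hle hk)]; exact hD.analytic_T k hk
    · rwa [hT']
  · intro k hk
    rcases hcases hk with hk | rfl
    · rw [hSn (hle hk)]; exact hD.analytic_S k hk
    · rwa [hS']
  · intro k hk
    rw [hF (hle hk), havgF k (hle hk)]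
    rcases hcases hk with hk | rfl
    · rw [hTn (hle hk)]; exact hD.homological_T k hk
    · rw [hT']; exact hTh
  · intro k hk
    rw [hG (hle hk), havgG k (hle hk)]
    rcases hcases hk with hk | rfl
    · rw [hSn (hle hk)]; exact hD.homological_S k hk
    · rw [hS']; exact hSh
  · intro k hk ψ I hI
    rw [hmap k (hle hk)]
    rcases hcases hk with hk | rfl
    · rw [hinv k (hle hk), hmap (k + 1) (by have := hle hk; lia)]; exact hD.conjugates k hk ψ I hI
    · filter_upwards [hR3 (ψ, I) ⟨mem_univ _, hI⟩] with q hq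
      rw [hinv', hinv', hmap', map_eq_partialMap]
      exact hq
  · intro k hk
    rcases hcases hk with hk | rfl
    · rw [hTn (hle hk), hSn (hle hk)]; exact hav k hk
    · rw [hT', hS']
      exact fun I hI => ⟨hTa I hI, hSa I hI⟩

theorem exists_isDecoupling (hM : IsOpen M) {ω₀ : Angle l} (hω₀ : IsDiophantine ω₀)
    {F : Angle l → Slow d → ℝ → Angle l} {G : Angle l → Slow d → ℝ → Slow d}
    (hF : IsAnalyticPerturbation M F) (hG : IsAnalyticPerturbation M G) (n : ℕ) :
    ∃ D : DecouplingData l d, D.IsDecoupling M ω₀ F G n ∧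
      ∀ k ∈ Finset.Icc 1 n, ∀ I ∈ M,
        (torusAverage fun ψ => D.T k ψ I) = 0 ∧ (torusAverage fun ψ => D.S k ψ I) = 0 := by
  induction n with
  | zero =>
    have h0 : ∀ k, k ∉ Finset.Icc 1 0 := by simp
    exact ⟨⟨fun _ => F, fun _ => G, 0, 0⟩, ⟨rfl, rfl, fun _ _ => hF, fun _ _ => hG,
      fun k hk => (h0 k hk).elim, fun k hk => (h0 k hk).elim, fun k hk => (h0 k hk).elim,
      fun k hk => (h0 k hk).elim, fun k hk => (h0 k hk).elim⟩, fun k hk => (h0 k hk).elim⟩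
  | succ n ih =>
    obtain ⟨D, hD, hav⟩ := ih
    exact hD.exists_succ hM hω₀ hav

end DecouplingData

end Existence

section Cutoff

variable {l d : ℕ} {M : Set (Slow d)} {W : Type*} [NormedAddCommGroup W] [NormedSpace ℝ W] [CompleteSpace W]

theorem exists_period_mem_Icc (z : Phase l d) : ∃ m, (z + period m).1 ∈ Icc (0 : Angle l) 1 := by
  refine ⟨fun i => -⌊z.1 i⌋, fun i => ?_, fun i => ?_⟩
  · have := Int.floor_le (z.1 i)
    simp [period]
    linarith
  · have := (Int.lt_floor_add_one (z.1 i)).le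
    simp [period]
    linarith

theorem snd_add_period (z : Phase l d) (m : Fin l → ℤ) : (z + period m).2 = z.2 := by
  simp [period]

theorem eventually_forall_of_periodic {P : Phase l d → ℝ → Prop} {C : Set (Slow d)}
    (hC : IsCompact C) (hP : ∀ z : Phase l d, z.2 ∈ C → ∀ᶠ q : Phase l d × ℝ in 𝓝 (z, 0), P q.1 q.2)
    (hper : ∀ m (z : Phase l d) κ, P (z + period m) κ → P z κ) :
    ∀ᶠ κ : ℝ in 𝓝 0, ∀ z : Phase l d, z.2 ∈ C → P z κ := by
  have h1 : ∀ᶠ κ : ℝ in 𝓝 0, ∀ z ∈ Icc (0 : Angle l) 1 ×ˢ C, P z κ := by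
    refine (isCompact_Icc.prod hC).eventually_forall_of_forall_eventually fun z hz => ?_
    exact (continuous_swap.tendsto ((0 : ℝ), z)).eventually (hP z hz.2)
  filter_upwards [h1] with κ h z hz
  obtain ⟨m, hm⟩ := exists_period_mem_Icc z
  exact hper m z κ (h _ ⟨hm, by rwa [snd_add_period]⟩)

theorem exists_lipschitz_cutoff (hM : IsOpen M) {X : Phase l d → W}
    (hX : AnalyticOnNhd ℝ X (univ ×ˢ M)) (hper : ∀ m (z : Phase l d), z.2 ∈ M → X (z + period m) = X z)
    {C : Set (Slow d)} (hC : IsCompact C) (hCM : C ⊆ M) :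
    ∃ Y : Phase l d → W, ∃ L : NNReal, ∃ B : ℝ, LipschitzWith L Y ∧ (∀ z, ‖Y z‖ ≤ B) ∧
      ∀ z : Phase l d, z.2 ∈ C → Y z = X z := by
  obtain ⟨t, ht, hCt, htM⟩ := exists_compact_between hC hM hCM
  obtain ⟨f, hf1, hf0, -⟩ := exists_contMDiffMap_one_nhds_of_subset_interior
    (modelWithCornersSelf ℝ (Slow d)) (n := 1) hC.isClosed hCt
  have hf : ContDiff ℝ 1 f := f.contMDiff.contDiff
  set Y : Phase l d → W := fun z => f z.2 • X z
  have hY0 : ∀ z : Phase l d, z.2 ∉ t → Y z = 0 := fun z hz => by simp [Y, hf0 z.2 hz]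
  have hev : ∀ z : Phase l d, z.2 ∉ t → Y =ᶠ[𝓝 z] fun _ => 0 := fun z hz => by
    filter_upwards [continuousAt_snd.preimage_mem_nhds (ht.isClosed.isOpen_compl.mem_nhds hz)] with w hw
    exact hY0 w hw
  have hYc : ContDiff ℝ 1 Y := contDiff_iff_contDiffAt.2 fun z => by
    by_cases hz : z.2 ∈ t
    · exact (hf.comp contDiff_snd).contDiffAt.smul (hX z ⟨mem_univ _, htM hz⟩).contDiffAt
    · exact contDiffAt_const.congr_of_eventuallyEq (hev z hz)
  have hYp : ∀ m z, Y (z + period m) = Y z := fun m z => by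
    by_cases hz : z.2 ∈ t
    · simp only [Y, snd_add_period, hper m z (htM hz)]
    · rw [hY0 z hz, hY0 _ (by rwa [snd_add_period])]
  have hdp : ∀ m z, fderiv ℝ Y (z + period m) = fderiv ℝ Y z := fun m z => by
    rw [← fderiv_comp_add_right]
    simp only [hYp]
  have hbd : ∀ {V : Type _} [NormedAddCommGroup V] (g : Phase l d → V), Continuous g →
      (∀ m z, g (z + period m) = g z) → (∀ z : Phase l d, z.2 ∉ t → g z = 0) →
      ∃ B : ℝ, ∀ z, ‖g z‖ ≤ B := by
    intro V _ g hg hgp hg0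
    obtain ⟨B, hB⟩ := (isCompact_Icc.prod ht : IsCompact (Icc (0 : Angle l) 1 ×ˢ t)
      ).exists_bound_of_continuousOn hg.continuousOn
    refine ⟨max B 0, fun z => ?_⟩
    by_cases hz : z.2 ∈ t
    · obtain ⟨m, hm⟩ := exists_period_mem_Icc z
      rw [← hgp m z]
      exact (hB _ ⟨hm, by rwa [snd_add_period]⟩).trans (le_max_left _ _)
    · simp [hg0 z hz]
  obtain ⟨B, hB⟩ := hbd Y hYc.continuous hYp hY0
  obtain ⟨L, hL⟩ := hbd (fderiv ℝ Y) (hYc.continuous_fderiv (by simp)) hdp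
    fun z hz => by rw [(hev z hz).fderiv_eq]; simp
  refine ⟨Y, L.toNNReal, B, ?_, hB, fun z hz => ?_⟩
  · refine lipschitzWith_of_nnnorm_fderiv_le (𝕜 := ℝ) (hYc.differentiable (by simp)) fun z => ?_
    rw [← norm_toNNReal]
    exact Real.toNNReal_le_toNNReal (hL z)
  · simp [Y, hf1.self_of_nhdsSet z.2 hz]

end Cutoff

section NearIdentity

variable {Z : Type*} [NormedAddCommGroup Z] [NormedSpace ℝ Z] [CompleteSpace Z]

theorem exists_homeomorph_of_lipschitz {Y : Z → Z} {L : NNReal} (hY : LipschitzWith L Y) {s : ℝ}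
    (hs : |s| * L < 1) : ∃ e : Z ≃ₜ Z, ∀ z, e z = z + s • Y z := by
  have happ : ApproximatesLinearOn (fun z => z + s • Y z)
      ((ContinuousLinearEquiv.refl ℝ Z : Z ≃L[ℝ] Z) : Z →L[ℝ] Z) univ (‖s‖₊ * L) := by
    intro x _ y _
    have h1 : x + s • Y x - (y + s • Y y) - (x - y) = s • (Y x - Y y) := by
      rw [smul_sub]; abel
    change ‖x + s • Y x - (y + s • Y y) - (x - y)‖ ≤ _
    rw [h1, norm_smul]
    push_cast
    rw [mul_assoc]
    gcongr
    exact hY.norm_sub_le x y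
  refine ⟨happ.toHomeomorph _ ?_, fun z => rfl⟩
  rcases subsingleton_or_nontrivial Z with h | h
  · exact Or.inl h
  · right
    have h1 : ‖((ContinuousLinearEquiv.refl ℝ Z).symm : Z →L[ℝ] Z)‖₊ = 1 := by
      rw [ContinuousLinearEquiv.refl_symm]
      exact NNReal.eq ContinuousLinearMap.norm_id
    rw [h1, inv_one, ← NNReal.coe_lt_coe]
    simpa using hs

theorem exists_openPartialHomeomorph_of_lipschitz {X Y : Z → Z} {L : NNReal} {B s : ℝ}
    (hY : LipschitzWith L Y) (hB : ∀ z, ‖Y z‖ ≤ B) (hs : |s| * L < 1) {D : Set Z} (hD : IsOpen D)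
    (hXY : ∀ z ∈ D, Y z = X z) (hX : AnalyticOnNhd ℝ X D) :
    ∃ h : OpenPartialHomeomorph Z Z, h.target = D ∧ (∀ z ∈ D, h.symm z = z + s • X z) ∧
      AnalyticOnNhd ℝ h h.source ∧ AnalyticOnNhd ℝ h.symm h.target ∧
      (∀ p, ∃ z, ‖z - p‖ ≤ |s| * B ∧ (z ∈ D → p ∈ h.source ∧ h p = z)) ∧
      ∀ p ∈ h.source, ‖h p - p‖ ≤ |s| * B := by
  obtain ⟨e, he⟩ := exists_homeomorph_of_lipschitz hY hs
  set h := (e.toOpenPartialHomeomorph.restrOpen D hD).symm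
  have htar : h.target = D := by simp [h]
  have hsymm : ∀ z, h.symm z = e z := fun z => rfl
  have hh : ∀ p, h p = e.symm p := fun p => rfl
  have hsrc : ∀ p, p ∈ h.source ↔ e.symm p ∈ D := fun p => by simp [h]
  have hdist : ∀ p, ‖e.symm p - p‖ ≤ |s| * B := fun p => by
    have h1 : p = e.symm p + s • Y (e.symm p) := by rw [← he, e.apply_symm_apply]
    have h2 : e.symm p - p = -(s • Y (e.symm p)) := by
      rw [eq_neg_iff_add_eq_zero, sub_add_eq_add_sub, ← h1, sub_self]
    rw [h2, norm_neg, norm_smul, Real.norm_eq_abs]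
    gcongr
    exact hB _
  have hsymm' : ∀ z ∈ D, h.symm z = z + s • X z := fun z hz => by rw [hsymm, he, hXY z hz]
  have han : ∀ z ∈ D, AnalyticAt ℝ h.symm z := fun z hz => by
    refine AnalyticAt.congr (f := fun z => z + s • X z) (analyticAt_id.add ((hX z hz).const_smul)) ?_
    filter_upwards [hD.mem_nhds hz] with w hw
    exact (hsymm' w hw).symm
  refine ⟨h, htar, hsymm', fun p hp => ?_, fun z hz => han z (htar ▸ hz),
    fun p => ⟨e.symm p, hdist p, fun hz => ⟨(hsrc p).2 hz, hh p⟩⟩, fun p _ => hdist p⟩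
  set z := h p
  have hz : z ∈ D := (hsrc p).1 hp
  have hfd : HasFDerivAt Y (fderiv ℝ X z) z :=
    (hX z hz).differentiableAt.hasFDerivAt.congr_of_eventuallyEq
      (by filter_upwards [hD.mem_nhds hz] with w hw using hXY w hw)
  have hn : ‖fderiv ℝ X z‖ ≤ L := by
    rw [← hfd.fderiv]; exact norm_fderiv_le_of_lipschitz ℝ hY
  have hlt : ‖-(s • fderiv ℝ X z)‖ < 1 := by
    rw [norm_neg, norm_smul, Real.norm_eq_abs]
    exact lt_of_le_of_lt (by gcongr) hs
  have hder : HasFDerivAt h.symm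
      ((ContinuousLinearEquiv.ofUnit (Units.oneSub _ hlt) : Z ≃L[ℝ] Z) : Z →L[ℝ] Z) z := by
    have h1 : HasFDerivAt (fun z => z + s • Y z) (.id ℝ Z + s • fderiv ℝ X z) z :=
      (hasFDerivAt_id z).add (hfd.const_smul s)
    have h2 : (h.symm : Z → Z) = fun z => z + s • Y z := funext fun z => he z
    rw [h2]
    convert! h1 using 1
    ext v
    change ((Units.oneSub _ hlt : (Z →L[ℝ] Z)ˣ) : Z →L[ℝ] Z) v = _
    simp
  have := h.symm.contDiffAt_symm (n := ⊤) (a := p) hp hder (han z hz).contDiffAt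
  exact this.analyticAt

end NearIdentity

section Uniform

variable {l d : ℕ} {M : Set (Slow d)} {D : DecouplingData l d} {ω₀ : Angle l}
  {F : Angle l → Slow d → ℝ → Angle l} {G : Angle l → Slow d → ℝ → Slow d} {n : ℕ}

namespace DecouplingData

theorem IsDecoupling.map_add_period (hD : D.IsDecoupling M ω₀ F G n) {k : ℕ}
    (hk : k ∈ Finset.Icc 1 (n + 1)) {z : Phase l d} (hz : z.2 ∈ M) (κ : ℝ) (m : Fin l → ℤ) :
    D.map ω₀ k κ (z + period m) = D.map ω₀ k κ z + period m := by
  have h1 : D.F k (z + period m).1 z.2 κ = D.F k z.1 z.2 κ :=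
    (hD.analytic_F k hk).periodic _ hz κ m z.1
  have h2 : D.G k (z + period m).1 z.2 κ = D.G k z.1 z.2 κ :=
    (hD.analytic_G k hk).periodic _ hz κ m z.1
  ext1
  · simp only [map, snd_add_period, h1]
    funext i
    simp only [Prod.fst_add, Pi.add_apply]
    ring
  · simp only [map, snd_add_period, h2]

theorem IsDecoupling.generator_add_period (hD : D.IsDecoupling M ω₀ F G n) {k : ℕ}
    (hk : k ∈ Finset.Icc 1 n) {z : Phase l d} (hz : z.2 ∈ M) (m : Fin l → ℤ) :
    D.generator k (z + period m) = D.generator k z := by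
  have h1 : D.T k (z + period m).1 z.2 = D.T k z.1 z.2 := (hD.analytic_T k hk).periodic _ hz m z.1
  have h2 : D.S k (z + period m).1 z.2 = D.S k z.1 z.2 := (hD.analytic_S k hk).periodic _ hz m z.1
  simp only [generator, snd_add_period, h1, h2]

theorem IsDecoupling.invStep_add_period (hD : D.IsDecoupling M ω₀ F G n) {k : ℕ}
    (hk : k ∈ Finset.Icc 1 n) {z : Phase l d} (hz : z.2 ∈ M) (κ : ℝ) (m : Fin l → ℤ) :
    D.invStep k κ (z + period m) = D.invStep k κ z + period m := by
  rw [invStep_eq, invStep_eq, hD.generator_add_period hk hz, add_right_comm]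

theorem IsDecoupling.analyticOnNhd_generator (hD : D.IsDecoupling M ω₀ F G n) {k : ℕ}
    (hk : k ∈ Finset.Icc 1 n) : AnalyticOnNhd ℝ (D.generator k) (univ ×ˢ M) := fun z hz =>
  ((hD.analytic_T k hk).analytic z hz).prod ((hD.analytic_S k hk).analytic z hz)

theorem IsDecoupling.eventually_conjugates (hM : IsOpen M) (hD : D.IsDecoupling M ω₀ F G n) {k : ℕ}
    (hk : k ∈ Finset.Icc 1 n) {C : Set (Slow d)} (hC : IsCompact C) (hCM : C ⊆ M) :
    ∀ᶠ κ : ℝ in 𝓝 0, ∀ z : Phase l d, z.2 ∈ C →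
      D.invStep k κ (D.map ω₀ (k + 1) κ z) = D.map ω₀ k κ (D.invStep k κ z) := by
  have hk1 := Finset.mem_Icc.1 hk
  have hk' : k ∈ Finset.Icc 1 (n + 1) := Finset.mem_Icc.2 (by lia)
  have hk'' : k + 1 ∈ Finset.Icc 1 (n + 1) := Finset.mem_Icc.2 (by lia)
  have h := eventually_forall_of_periodic (P := fun (z : Phase l d) κ => z.2 ∈ M ∧
    (D.map ω₀ (k + 1) κ z).2 ∈ M ∧ (D.invStep k κ z).2 ∈ M ∧
      D.invStep k κ (D.map ω₀ (k + 1) κ z) = D.map ω₀ k κ (D.invStep k κ z)) hC ?_ ?_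
  · filter_upwards [h] with κ hκ z hz using (hκ z hz).2.2.2
  · intro z hz
    have hzM : M ∈ 𝓝 z.2 := hM.mem_nhds (hCM hz)
    have h1 : ContinuousAt (fun q : Phase l d × ℝ => (D.map ω₀ (k + 1) q.2 q.1).2) (z, 0) := by
      simp only [map_eq_partialMap]
      refine continuousAt_snd.comp (analyticAt_partialMap (fun i hi => ?_) ?_).continuousAt
      · exact hD.analyticOnNhd_avg (by simp at hi ⊢; lia) (hCM hz)
      · exact ((hD.analytic_F _ hk'').analyticAt (hCM hz)).prod
          ((hD.analytic_G _ hk'').analyticAt (hCM hz))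
    have h2 : ContinuousAt (fun q : Phase l d × ℝ => (D.invStep k q.2 q.1).2) (z, 0) := by
      simp only [invStep_eq]
      refine continuousAt_snd.comp (analyticAt_fst.add (analyticAt_pow_smul ?_ k)).continuousAt
      exact (hD.analyticOnNhd_generator hk z ⟨mem_univ _, hCM hz⟩).comp_of_eq analyticAt_fst rfl
    have h1' := h1.preimage_mem_nhds (t := M) (by
      rw [map_eq_partialMap, partialMap_zero (by lia)]
      simpa using hzM)
    have h2' := h2.preimage_mem_nhds (t := M) (by
      rw [invStep_eq, zero_pow (by lia)]
      simpa using hzM)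
    have h3 := (continuousAt_snd.comp (continuousAt_fst (p := (z, (0 : ℝ))))).preimage_mem_nhds hzM
    filter_upwards [h1', h2', h3, hD.conjugates k hk z.1 z.2 (hCM hz)] with q a1 a2 a3 a4
    exact ⟨a3, a1, a2, a4⟩
  · rintro m z κ ⟨a1, a2, a3, a4⟩
    rw [snd_add_period] at a1
    rw [hD.map_add_period hk'' a1, snd_add_period] at a2
    rw [hD.invStep_add_period hk a1, snd_add_period] at a3
    rw [hD.map_add_period hk'' a1, hD.invStep_add_period hk a1, hD.invStep_add_period hk a2,
      hD.map_add_period hk' a3] at a4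
    exact ⟨a1, a2, a3, add_right_cancel a4⟩

theorem IsDecoupling.eventually_norm_G_le (hD : D.IsDecoupling M ω₀ F G n) {k : ℕ}
    (hk : k ∈ Finset.Icc 1 (n + 1)) {C : Set (Slow d)} (hC : IsCompact C) (hCM : C ⊆ M) :
    ∃ B ≥ 0, ∀ᶠ κ : ℝ in 𝓝 0, ∀ z : Phase l d, z.2 ∈ C → ‖D.G k z.1 z.2 κ‖ ≤ B := by
  have hG := hD.analytic_G k hk
  have hc : ContinuousOn (fun z : Phase l d => D.G k z.1 z.2 0) (Icc (0 : Angle l) 1 ×ˢ C) :=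
    fun z hz => (hG.slice.analytic z ⟨mem_univ _, hCM hz.2⟩).continuousAt.continuousWithinAt
  obtain ⟨B, hB⟩ := (isCompact_Icc.prod hC).exists_bound_of_continuousOn hc
  have hper : ∀ m (z : Phase l d) κ, z.2 ∈ C →
      D.G k (z + period m).1 (z + period m).2 κ = D.G k z.1 z.2 κ := fun m z κ hz => by
    rw [snd_add_period]
    exact hG.periodic _ (hCM hz) κ m z.1
  have hB' : ∀ z : Phase l d, z.2 ∈ C → ‖D.G k z.1 z.2 0‖ ≤ B := fun z hz => by
    obtain ⟨m, hm⟩ := exists_period_mem_Icc z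
    rw [← hper m z 0 hz]
    exact hB _ ⟨hm, by rwa [snd_add_period]⟩
  refine ⟨max (B + 1) 0, le_max_right _ _, ?_⟩
  have h := eventually_forall_of_periodic
    (P := fun (z : Phase l d) κ => z.2 ∈ C → ‖D.G k z.1 z.2 κ‖ ≤ B + 1) hC ?_ ?_
  · filter_upwards [h] with κ hκ z hz using (hκ z hz hz).trans (le_max_left _ _)
  · intro z hz
    have h1 := (hG.analyticAt (z := z) (hCM hz)).continuousAt.norm.eventually_lt
      (continuousAt_const (y := B + 1)) (lt_of_le_of_lt (hB' z hz) (lt_add_one B))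
    filter_upwards [h1] with q hq _ using hq.le
  · intro m z κ h hz
    rw [← hper m z κ hz]
    exact h (by rwa [snd_add_period])

theorem IsDecoupling.exists_lipschitz_avgG (hM : IsOpen M) (hD : D.IsDecoupling M ω₀ F G n) {k : ℕ}
    (hk : k ∈ Finset.Icc 1 (n + 1)) {C : Set (Slow d)} (hC : IsCompact C) (hCM : C ⊆ M) :
    ∃ L ≥ (0 : ℝ), ∀ x ∈ C, ∀ y ∈ C, ‖D.avgG k x - D.avgG k y‖ ≤ L * ‖x - y‖ := by
  obtain ⟨Y, L, -, hY, -, hYX⟩ := exists_lipschitz_cutoff (l := l) hM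
    (X := fun z => D.avgG k z.2)
    (fun z hz => ((hD.analytic_G k hk).slice.average z.2 hz.2).comp_of_eq analyticAt_snd rfl)
    (fun m z _ => by simp only [snd_add_period]) hC hCM
  refine ⟨L, L.2, fun x hx y hy => ?_⟩
  have h := hY.norm_sub_le (0, x) (0, y)
  rw [hYX _ hx, hYX _ hy] at h
  simpa [Prod.norm_def] using h

/-- The properties of the decoupling diffeomorphism `h^{(k)}` that enter the composition: it is
defined and `ρ`-close to the identity. -/
structure IsCloseStep (M U : Set (Slow d)) (D : DecouplingData l d) (k : ℕ) (κ ρ : ℝ)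
    (h : OpenPartialHomeomorph (Phase l d) (Phase l d)) : Prop where
  diffeo : D.IsStepDiffeo M U k κ h
  exists_apply : ∀ p, ∃ z, ‖z - p‖ ≤ ρ ∧ (z.2 ∈ U → p ∈ h.source ∧ h p = z)
  norm_symm_sub_le : ∀ z : Phase l d, z.2 ∈ U → ‖h.symm z - z‖ ≤ ρ

theorem IsDecoupling.eventually_exists_isCloseStep (hM : IsOpen M) (hD : D.IsDecoupling M ω₀ F G n)
    {k : ℕ} (hk : k ∈ Finset.Icc 1 n) {U : Set (Slow d)} (hU : IsOpen U)
    (hUc : IsCompact (closure U)) (hUM : closure U ⊆ M) {ρ : ℝ} (hρ : 0 < ρ) :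
    ∀ᶠ κ : ℝ in 𝓝 0, ∃ h, D.IsCloseStep M U k κ ρ h := by
  have hk1 := Finset.mem_Icc.1 hk
  obtain ⟨Y, L, B, hY, hB, hYX⟩ := exists_lipschitz_cutoff hM (hD.analyticOnNhd_generator hk)
    (fun m z hz => hD.generator_add_period hk hz m) hUc hUM
  obtain ⟨δ, hδ, hδM⟩ := hUc.exists_cthickening_subset_open hM hUM
  have hpow : Tendsto (fun κ : ℝ => |κ ^ k|) (𝓝 0) (𝓝 0) := by
    have : Continuous fun κ : ℝ => |κ ^ k| := by fun_prop
    simpa [zero_pow (show k ≠ 0 by lia)] using this.tendsto 0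
  have h1 : ∀ᶠ κ : ℝ in 𝓝 0, |κ ^ k| * L < 1 :=
    (hpow.mul_const (L : ℝ)).eventually_lt_const (by simp)
  have h2 : ∀ᶠ κ : ℝ in 𝓝 0, |κ ^ k| * B < min ρ δ :=
    (hpow.mul_const B).eventually_lt_const (by simp [hρ, hδ])
  filter_upwards [h1, h2] with κ hκ1 hκ2
  have hsub : (univ ×ˢ U : Set (Phase l d)) ⊆ univ ×ˢ M :=
    prod_mono subset_rfl (subset_closure.trans hUM)
  obtain ⟨h, a1, a2, a3, a4, a5, a6⟩ := exists_openPartialHomeomorph_of_lipschitz hY hB hκ1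
    (isOpen_univ.prod hU) (fun z hz => hYX z (subset_closure hz.2))
    ((hD.analyticOnNhd_generator hk).mono hsub)
  refine ⟨h, ⟨fun p hp => ⟨mem_univ _, ?_⟩, a1, fun z hz => a2 z hz, a3, a4⟩, fun p => ?_, fun z hz => ?_⟩
  · have hq : h p ∈ univ ×ˢ U := a1 ▸ h.map_source hp
    refine hδM (Metric.mem_cthickening_of_dist_le p.2 (h p).2 δ _ (subset_closure hq.2) ?_)
    rw [dist_eq_norm, norm_sub_rev]
    exact (norm_snd_le (h p - p)).trans ((a6 p hp).trans (hκ2.le.trans (min_le_right _ _)))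
  · obtain ⟨z, hz, hz'⟩ := a5 p
    exact ⟨z, hz.trans (hκ2.le.trans (min_le_left _ _)), fun hzU => hz' ⟨mem_univ _, hzU⟩⟩
  · have hz' : z ∈ h.target := by rw [a1]; exact ⟨mem_univ _, hz⟩
    have := a6 _ (h.map_target hz')
    rw [h.right_inv hz', norm_sub_rev] at this
    exact this.trans (hκ2.le.trans (min_le_left _ _))

end DecouplingData

end Uniform

section Dynamics

variable {l d : ℕ} {M K U : Set (Slow d)} {D : DecouplingData l d} {ω₀ : Angle l}
  {F : Angle l → Slow d → ℝ → Angle l} {G : Angle l → Slow d → ℝ → Slow d} {n : ℕ} {κ ρ δ : ℝ}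
  {h : ℕ → OpenPartialHomeomorph (Phase l d) (Phase l d)}

/-- `x` has distance at most `r` from a point of `K`. -/
def IsNear (K : Set (Slow d)) (r : ℝ) (x : Slow d) : Prop := ∃ y ∈ K, ‖x - y‖ ≤ r

theorem IsNear.mono {r r' : ℝ} {x : Slow d} (hx : IsNear K r x) (hr : r ≤ r') : IsNear K r' x :=
  hx.imp fun _ hy => ⟨hy.1, hy.2.trans hr⟩

theorem IsNear.of_norm_sub_le {r s : ℝ} {x x' : Slow d} (hx : IsNear K r x) (hs : ‖x' - x‖ ≤ s) :
    IsNear K (r + s) x' := by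
  obtain ⟨y, hy, hxy⟩ := hx
  refine ⟨y, hy, ?_⟩
  have := norm_add_le (x' - x) (x - y)
  rw [sub_add_sub_cancel] at this
  linarith

namespace DecouplingData

theorem mem_compose_target (hU : ∀ x, IsNear K δ x → x ∈ U) (hρ : 0 ≤ ρ)
    (hstep : ∀ k ∈ Finset.Icc 1 n, D.IsCloseStep M U k κ ρ (h k)) {j : ℕ} (hj : j ≤ n) :
    ∀ {r : ℝ} {z : Phase l d}, IsNear K r z.2 → r + j * ρ ≤ δ → z ∈ (compose h j).target := by
  induction j with
  | zero => intro r z _ _; exact mem_univ z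
  | succ j ih =>
    intro r z hz hr
    have hs := hstep (j + 1) (Finset.mem_Icc.2 ⟨by lia, hj⟩)
    push_cast at hr
    have hjρ : 0 ≤ j * ρ := by positivity
    have hzU : z.2 ∈ U := hU _ (hz.mono (by linarith))
    rw [compose, OpenPartialHomeomorph.trans_target]
    refine ⟨by rw [hs.diffeo.target_eq]; exact ⟨mem_univ _, hzU⟩, ih (by lia) (r := r + ρ) ?_ (by linarith)⟩
    exact hz.of_norm_sub_le ((norm_snd_le ((h (j + 1)).symm z - z)).trans (hs.norm_symm_sub_le z hzU))

theorem compose_symm_conjugates (hU : ∀ x, IsNear K δ x → x ∈ U) (hρ : 0 ≤ ρ)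
    (hstep : ∀ k ∈ Finset.Icc 1 n, D.IsCloseStep M U k κ ρ (h k))
    (hconj : ∀ k ∈ Finset.Icc 1 n, ∀ z : Phase l d, z.2 ∈ U →
      D.invStep k κ (D.map ω₀ (k + 1) κ z) = D.map ω₀ k κ (D.invStep k κ z)) {j : ℕ} (hj : j ≤ n) :
    ∀ {r : ℝ} {z : Phase l d}, IsNear K r z.2 → IsNear K r (D.map ω₀ (j + 1) κ z).2 →
      r + j * ρ ≤ δ →
      D.map ω₀ 1 κ ((compose h j).symm z) = (compose h j).symm (D.map ω₀ (j + 1) κ z) := by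
  induction j with
  | zero => intro r z _ _ _; rfl
  | succ j ih =>
    intro r z hz hz' hr
    have hmem : j + 1 ∈ Finset.Icc 1 n := Finset.mem_Icc.2 ⟨by lia, hj⟩
    have hs := hstep (j + 1) hmem
    push_cast at hr
    have hjρ : 0 ≤ j * ρ := by positivity
    have hzU : z.2 ∈ U := hU _ (hz.mono (by linarith))
    have hzU' : (D.map ω₀ (j + 1 + 1) κ z).2 ∈ U := hU _ (hz'.mono (by linarith))
    have hnear : ∀ w : Phase l d, w.2 ∈ U → IsNear K r w.2 → IsNear K (r + ρ) ((h (j + 1)).symm w).2 :=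
      fun w hw hwr => hwr.of_norm_sub_le
        ((norm_snd_le ((h (j + 1)).symm w - w)).trans (hs.norm_symm_sub_le w hw))
    have h1 : (h (j + 1)).symm (D.map ω₀ (j + 1 + 1) κ z) = D.map ω₀ (j + 1) κ ((h (j + 1)).symm z) := by
      rw [hs.diffeo.symm_eq ⟨mem_univ _, hzU'⟩, hs.diffeo.symm_eq ⟨mem_univ _, hzU⟩]
      exact hconj (j + 1) hmem z hzU
    have h2 := ih (by lia) (r := r + ρ) (hnear z hzU hz)
      (by rw [← h1]; exact hnear _ hzU' hz') (by linarith)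
    change D.map ω₀ 1 κ ((compose h j).symm ((h (j + 1)).symm z)) =
      (compose h j).symm ((h (j + 1)).symm (D.map ω₀ (j + 1 + 1) κ z))
    rw [h2, h1]

theorem mem_compose_source (hU : ∀ x, IsNear K δ x → x ∈ U) (hρ : 0 ≤ ρ)
    (hstep : ∀ k ∈ Finset.Icc 1 n, D.IsCloseStep M U k κ ρ (h k)) {p : Phase l d} (hp : p.2 ∈ K)
    {j : ℕ} (hj : j ≤ n) (hjδ : j * ρ ≤ δ) :
    p ∈ (compose h j).source ∧ IsNear K (j * ρ) (compose h j p).2 := by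
  induction j with
  | zero => exact ⟨mem_univ _, p.2, hp, by simp [compose]⟩
  | succ j ih =>
    have hs := hstep (j + 1) (Finset.mem_Icc.2 ⟨by lia, hj⟩)
    push_cast at hjδ
    obtain ⟨h1, h2⟩ := ih (by lia) (by linarith)
    obtain ⟨z, hz, hzU⟩ := hs.exists_apply (compose h j p)
    have h3 := h2.of_norm_sub_le ((norm_snd_le (z - compose h j p)).trans hz)
    have h4 : IsNear K ((j + 1 : ℕ) * ρ) z.2 := h3.mono (by push_cast; linarith)
    obtain ⟨h5, h6⟩ := hzU (hU _ (h3.mono (by linarith)))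
    rw [compose, OpenPartialHomeomorph.trans_source]
    refine ⟨⟨h1, h5⟩, ?_⟩
    rw [OpenPartialHomeomorph.coe_trans, Function.comp_apply, h6]
    exact h4

theorem map_one_eq (hD : D.IsDecoupling M ω₀ F G n) : D.map ω₀ 1 κ = slowFastMap ω₀ F G κ := by
  ext1 z
  simp [map, slowFastMap, hD.F_one, hD.G_one]

theorem norm_map_sub_averagedMap_le {L : ℕ → ℝ} {B : ℝ} (hκ : 0 ≤ κ) (hκ1 : κ ≤ 1)
    {z : Phase l d} {I : Slow d}
    (hL : ∀ k ∈ Finset.Icc 1 n, ‖D.avgG k z.2 - D.avgG k I‖ ≤ L k * ‖z.2 - I‖)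
    (hB : ‖D.G (n + 1) z.1 z.2 κ‖ ≤ B) :
    ‖(D.map ω₀ (n + 1) κ z).2 - D.averagedMap n κ I‖ ≤
      (1 + κ * ∑ k ∈ Finset.Icc 1 n, L k) * ‖z.2 - I‖ + κ ^ (n + 1) * B := by
  have h1 : (D.map ω₀ (n + 1) κ z).2 - D.averagedMap n κ I =
      (z.2 - I) + ∑ k ∈ Finset.Icc 1 n, κ ^ k • (D.avgG k z.2 - D.avgG k I) +
        κ ^ (n + 1) • D.G (n + 1) z.1 z.2 κ := by
    have : Finset.Ico 1 (n + 1) = Finset.Icc 1 n := by ext; simp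
    simp only [map, averagedMap, this, smul_sub, Finset.sum_sub_distrib]
    abel
  rw [h1]
  refine (norm_add_le _ _).trans (add_le_add ((norm_add_le _ _).trans ?_) ?_)
  · rw [add_mul, one_mul, Finset.mul_sum, Finset.sum_mul]
    gcongr
    refine (norm_sum_le _ _).trans (Finset.sum_le_sum fun k hk => ?_)
    rw [norm_smul, Real.norm_of_nonneg (by positivity), mul_assoc]
    have h2 : κ ^ k ≤ κ := by
      simpa using pow_le_pow_of_le_one hκ hκ1 (Finset.mem_Icc.1 hk).1
    exact mul_le_mul h2 (hL k hk) (norm_nonneg _) hκ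
  · rw [norm_smul, Real.norm_of_nonneg (by positivity)]
    gcongr

theorem orbit_estimate (hD : D.IsDecoupling M ω₀ F G n) (hU : ∀ x, IsNear K δ x → x ∈ U)
    (hKU : K ⊆ U) (hρ : 0 ≤ ρ) (hρδ : ρ + n * ρ ≤ δ)
    (hstep : ∀ k ∈ Finset.Icc 1 n, D.IsCloseStep M U k κ ρ (h k))
    (hconj : ∀ k ∈ Finset.Icc 1 n, ∀ z : Phase l d, z.2 ∈ U →
      D.invStep k κ (D.map ω₀ (k + 1) κ z) = D.map ω₀ k κ (D.invStep k κ z))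
    {L : ℕ → ℝ} (hL0 : ∀ k ∈ Finset.Icc 1 n, 0 ≤ L k)
    (hL : ∀ k ∈ Finset.Icc 1 n, ∀ x ∈ U, ∀ y ∈ U, ‖D.avgG k x - D.avgG k y‖ ≤ L k * ‖x - y‖)
    {B : ℝ} (hB0 : 0 ≤ B) (hB : ∀ z : Phase l d, z.2 ∈ U → ‖D.G (n + 1) z.1 z.2 κ‖ ≤ B)
    {τ : ℝ} (hτ : 0 < τ) (hκ : 0 < κ) (hκ1 : κ ≤ 1)
    (hsmall : B * τ * Real.exp ((∑ k ∈ Finset.Icc 1 n, L k) * τ) * κ ^ n ≤ ρ)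
    {I₀ : Slow d} (hI : ∀ t : ℕ, (t : ℝ) < τ / κ → (D.averagedMap n κ)^[t] I₀ ∈ K)
    {p₀ : Phase l d} (hp₀ : p₀ ∈ (compose h n).source) (hpI : (compose h n p₀).2 = I₀)
    (t : ℕ) (ht : (t : ℝ) < τ / κ) :
    (slowFastMap ω₀ F G κ)^[t] p₀ ∈ (compose h n).source ∧
      ‖(compose h n ((slowFastMap ω₀ F G κ)^[t] p₀)).2 - (D.averagedMap n κ)^[t] I₀‖ ≤
        B * τ * Real.exp ((∑ k ∈ Finset.Icc 1 n, L k) * τ) * κ ^ n := by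
  set Λ := ∑ k ∈ Finset.Icc 1 n, L k
  have hΛ : 0 ≤ Λ := Finset.sum_nonneg hL0
  have hbound : ∀ t : ℕ, (t : ℝ) < τ / κ →
      B * κ ^ (n + 1) * t * (1 + κ * Λ) ^ t ≤ B * τ * Real.exp (Λ * τ) * κ ^ n := fun t ht => by
    have h1 : t * κ ≤ τ := ((lt_div_iff₀ hκ).1 ht).le
    have h2 : (1 + κ * Λ) ^ t ≤ Real.exp (Λ * τ) := by
      calc (1 + κ * Λ) ^ t ≤ Real.exp (κ * Λ) ^ t := by
            gcongr; rw [add_comm]; exact Real.add_one_le_exp _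
        _ = Real.exp (Λ * (t * κ)) := by rw [← Real.exp_nat_mul]; ring_nf
        _ ≤ _ := by gcongr
    calc B * κ ^ (n + 1) * t * (1 + κ * Λ) ^ t = B * (t * κ) * (1 + κ * Λ) ^ t * κ ^ n := by ring
      _ ≤ _ := by gcongr
  suffices hmain : (slowFastMap ω₀ F G κ)^[t] p₀ ∈ (compose h n).source ∧
      ‖(compose h n ((slowFastMap ω₀ F G κ)^[t] p₀)).2 - (D.averagedMap n κ)^[t] I₀‖ ≤
        B * κ ^ (n + 1) * t * (1 + κ * Λ) ^ t from ⟨hmain.1, hmain.2.trans (hbound t ht)⟩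
  induction t with
  | zero => exact ⟨hp₀, by simp [hpI]⟩
  | succ t ih =>
    have ht' : (t : ℝ) < τ / κ := lt_trans (by push_cast; linarith) ht
    obtain ⟨h1, h2⟩ := ih ht'
    rw [Function.iterate_succ_apply', Function.iterate_succ_apply']
    have hK1 := hI t ht'
    have hK2 := hI (t + 1) ht
    rw [Function.iterate_succ_apply'] at hK2
    set p := (slowFastMap ω₀ F G κ)^[t] p₀
    set I := (D.averagedMap n κ)^[t] I₀
    set q := compose h n p
    have hq : IsNear K ρ q.2 := ⟨I, hK1, h2.trans ((hbound t ht').trans hsmall)⟩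
    have hnρ : 0 ≤ n * ρ := by positivity
    have hqU : q.2 ∈ U := hU _ (hq.mono (by linarith))
    have h3 := norm_map_sub_averagedMap_le (ω₀ := ω₀) hκ.le hκ1
      (fun k hk => hL k hk q.2 hqU I (hKU hK1)) (hB q hqU)
    have h4 : ‖(D.map ω₀ (n + 1) κ q).2 - D.averagedMap n κ I‖ ≤
        B * κ ^ (n + 1) * (t + 1 : ℕ) * (1 + κ * Λ) ^ (t + 1) := by
      refine h3.trans ?_
      have h5 : 1 ≤ (1 + κ * Λ) ^ (t + 1) := one_le_pow₀ (by
        have : 0 ≤ κ * Λ := by positivity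
        linarith)
      calc _ ≤ (1 + κ * Λ) * (B * κ ^ (n + 1) * t * (1 + κ * Λ) ^ t) + κ ^ (n + 1) * B * 1 := by
            rw [mul_one]; gcongr
        _ ≤ (1 + κ * Λ) * (B * κ ^ (n + 1) * t * (1 + κ * Λ) ^ t) +
            κ ^ (n + 1) * B * (1 + κ * Λ) ^ (t + 1) := by gcongr
        _ = _ := by push_cast; ring
    have hq' : IsNear K ρ (D.map ω₀ (n + 1) κ q).2 :=
      ⟨_, hK2, h4.trans ((hbound (t + 1) ht).trans hsmall)⟩
    have h6 := compose_symm_conjugates hU hρ hstep hconj le_rfl hq hq' hρδ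
    rw [(compose h n).left_inv h1, map_one_eq hD] at h6
    have h7 := mem_compose_target hU hρ hstep le_rfl hq' hρδ
    rw [h6]
    refine ⟨(compose h n).map_target h7, ?_⟩
    rw [(compose h n).right_inv h7]
    exact h4

theorem IsDecoupling.averaging (hM : IsOpen M) (hD : D.IsDecoupling M ω₀ F G n) (hK : IsCompact K)
    (hKU : K ⊆ U) (hU : IsOpen U) (hUc : IsCompact (closure U)) (hUM : closure U ⊆ M) {τ : ℝ}
    (hτ : 0 < τ) (hn : 1 ≤ n) :
    ∃ κ₀ > (0 : ℝ), ∃ C : ℝ, ∀ κ : ℝ, |κ| < κ₀ →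
      ∃ h : ℕ → OpenPartialHomeomorph (Phase l d) (Phase l d),
        (∀ k ∈ Finset.Icc 1 n, D.IsStepDiffeo M U k κ (h k)) ∧
        univ ×ˢ K ⊆ (compose h n).source ∧ univ ×ˢ K ⊆ (compose h n).target ∧
        (0 < κ → ∀ Ibar₀ : Slow d,
          (∀ t : ℕ, (t : ℝ) < τ / κ → (D.averagedMap n κ)^[t] Ibar₀ ∈ K) →
          ∀ p₀ ∈ (compose h n).source, (compose h n p₀).2 = Ibar₀ →
            ∀ t : ℕ, (t : ℝ) < τ / κ →
              (slowFastMap ω₀ F G κ)^[t] p₀ ∈ (compose h n).source ∧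
              ‖(compose h n ((slowFastMap ω₀ F G κ)^[t] p₀)).2 -
                  (D.averagedMap n κ)^[t] Ibar₀‖ ≤ C * κ ^ n) := by
  obtain ⟨δ, hδ, hδU⟩ := hK.exists_cthickening_subset_open hU hKU
  have hnear : ∀ x, IsNear K δ x → x ∈ U := fun x ⟨y, hy, hxy⟩ =>
    hδU (Metric.mem_cthickening_of_dist_le x y δ K hy (by rwa [dist_eq_norm]))
  set ρ := δ / (n + 1)
  have hρ : 0 < ρ := by positivity
  have hρδ : ρ + n * ρ ≤ δ := by
    have : ρ * (n + 1) = δ := div_mul_cancel₀ _ (by positivity)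
    linarith
  have hsucc : ∀ k ∈ Finset.Icc 1 n, k ∈ Finset.Icc 1 (n + 1) := fun k hk => by
    simp at hk ⊢; lia
  have hLex : ∀ k, ∃ L : ℝ, k ∈ Finset.Icc 1 n → 0 ≤ L ∧
      ∀ x ∈ closure U, ∀ y ∈ closure U, ‖D.avgG k x - D.avgG k y‖ ≤ L * ‖x - y‖ := fun k => by
    by_cases hk : k ∈ Finset.Icc 1 n
    · obtain ⟨L, h1, h2⟩ := hD.exists_lipschitz_avgG hM (hsucc k hk) hUc hUM
      exact ⟨L, fun _ => ⟨h1, h2⟩⟩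
    · exact ⟨0, fun h => (hk h).elim⟩
  choose L hL using hLex
  obtain ⟨B, hB0, hB⟩ := hD.eventually_norm_G_le (k := n + 1) (by simp) hUc hUM
  set C := B * τ * Real.exp ((∑ k ∈ Finset.Icc 1 n, L k) * τ)
  have hsmall : ∀ᶠ κ : ℝ in 𝓝 0, C * κ ^ n < ρ := by
    have h1 : Continuous fun κ : ℝ => C * κ ^ n := by fun_prop
    have h2 := h1.tendsto 0
    rw [zero_pow (by lia), mul_zero] at h2
    exact h2.eventually_lt_const hρ
  have hone : ∀ᶠ κ : ℝ in 𝓝 0, κ < 1 := eventually_lt_nhds zero_lt_one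
  have hstep : ∀ᶠ κ : ℝ in 𝓝 0, ∀ k ∈ Finset.Icc 1 n, ∃ h, D.IsCloseStep M U k κ ρ h :=
    (Filter.eventually_all_finset _).2 fun k hk =>
      hD.eventually_exists_isCloseStep hM hk hU hUc hUM hρ
  have hconj : ∀ᶠ κ : ℝ in 𝓝 0, ∀ k ∈ Finset.Icc 1 n, ∀ z : Phase l d, z.2 ∈ closure U →
      D.invStep k κ (D.map ω₀ (k + 1) κ z) = D.map ω₀ k κ (D.invStep k κ z) :=
    (Filter.eventually_all_finset _).2 fun k hk => hD.eventually_conjugates hM hk hUc hUM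
  obtain ⟨κ₀, hκ₀, hall⟩ := Metric.eventually_nhds_iff.1
    (hB.and (hsmall.and (hone.and (hstep.and hconj))))
  refine ⟨κ₀, hκ₀, C, fun κ hκ => ?_⟩
  obtain ⟨hBκ, hCκ, hκ1, hsκ, hcκ⟩ := hall (by simpa using hκ)
  have hsκ' : ∀ k, ∃ h, k ∈ Finset.Icc 1 n → D.IsCloseStep M U k κ ρ h := fun k => by
    by_cases hk : k ∈ Finset.Icc 1 n
    · exact (hsκ k hk).imp fun h hh _ => hh
    · exact ⟨OpenPartialHomeomorph.refl _, fun h => (hk h).elim⟩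
  choose h hh using hsκ'
  refine ⟨h, fun k hk => (hh k hk).diffeo, fun p hp => ?_, fun z hz => ?_, ?_⟩
  · exact (mem_compose_source hnear hρ.le hh hp.2 le_rfl (by linarith)).1
  · exact mem_compose_target hnear hρ.le hh le_rfl (r := 0) ⟨z.2, hz.2, by simp⟩ (by linarith)
  · intro hκ0 I₀ hI p₀ hp₀ hpI t ht
    exact orbit_estimate hD hnear hKU hρ.le hρδ hh
      (fun k hk z hz => hcκ k hk z (subset_closure hz)) (fun k hk => (hL k hk).1)
      (fun k hk x hx y hy => (hL k hk).2 x (subset_closure hx) y (subset_closure hy)) hB0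
      (fun z hz => hBκ z (subset_closure hz)) hτ hκ0 hκ1.le hCκ.le hI hp₀ hpI t ht

end DecouplingData

end Dynamics

end SlowFast

end

open SlowFast in
theorem mainTheorem1 (l d : ℕ) (M : Set (Slow d)) (hM : IsOpen M)
    (ω₀ : Angle l) (hω₀ : IsDiophantine ω₀)
    (F : Angle l → Slow d → ℝ → Angle l) (G : Angle l → Slow d → ℝ → Slow d)
    (hF : IsAnalyticPerturbation M F) (hG : IsAnalyticPerturbation M G)
    (n : ℕ) (hn : 1 ≤ n) :
    -- the `n` decoupling steps can be performed, with generators of zero average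
    (∃ D : DecouplingData l d, D.IsDecoupling M ω₀ F G n ∧
      ∀ k ∈ Finset.Icc 1 n, ∀ I ∈ M,
        (torusAverage fun ψ => D.T k ψ I) = 0 ∧ (torusAverage fun ψ => D.S k ψ I) = 0) ∧
    -- and, however they are performed, the averaging estimate holds
    ∀ D : DecouplingData l d, D.IsDecoupling M ω₀ F G n →
      ∀ K U : Set (Slow d), IsCompact K → K ⊆ U → IsOpen U → IsCompact (closure U) →
        closure U ⊆ M →
      ∀ τ : ℝ, 0 < τ →
      ∃ κ₀ > (0 : ℝ), ∃ C : ℝ, ∀ κ : ℝ, |κ| < κ₀ →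
        ∃ h : ℕ → OpenPartialHomeomorph (Phase l d) (Phase l d),
          (∀ k ∈ Finset.Icc 1 n, D.IsStepDiffeo M U k κ (h k)) ∧
          univ ×ˢ K ⊆ (compose h n).source ∧ univ ×ˢ K ⊆ (compose h n).target ∧
          (0 < κ → ∀ Ibar₀ : Slow d,
            (∀ t : ℕ, (t : ℝ) < τ / κ → (D.averagedMap n κ)^[t] Ibar₀ ∈ K) →
            ∀ p₀ ∈ (compose h n).source, (compose h n p₀).2 = Ibar₀ →
              ∀ t : ℕ, (t : ℝ) < τ / κ →
                (slowFastMap ω₀ F G κ)^[t] p₀ ∈ (compose h n).source ∧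
                ‖(compose h n ((slowFastMap ω₀ F G κ)^[t] p₀)).2 -
                    (D.averagedMap n κ)^[t] Ibar₀‖ ≤ C * κ ^ n) :=
  ⟨DecouplingData.exists_isDecoupling hM hω₀ hF hG n, fun _ hD _ _ hK hKU hU hUc hUM _ hτ =>
    hD.averaging hM hK hKU hU hUc hUM hτ hn⟩
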